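/- Let $m\ge 1$ and $n:=2m-1$. **Degenerate side.** Let $V=\mathbb{C}^{n+1}=\mathbb{C}^{2m}$ with basis $f_1,\dots,f_{2m}$, and let $\mathrm{pr}_k:V\to V$ be the projection along the line spanned by $f_k$ (so $f_k\mapsto 0$ and $f_l\mapsto f_l$ for $l\ne k$). Put $k^*:=2m-1-k$ for $1\le k\le 2m-2$, $(2m-1)^*:=2m$, $(2m)^*:=2m-1$, and let $b_V$ be any nondegenerate alternating bilinear form on $V$ with $b_V(f_k,f_l)=0$ whenever $l\ne k^*$. Let $$\mathcal{F}l^a_{n+1}=\Big\{(V_1,\dots,V_n)\in\prod_{i=1}^n \mathrm{Gr}_i(V)\ \Big|\ \mathrm{pr}_i(V_i)\subseteq V_{i+1}\ (1\le i\le n-1)\Big\},$$ and let the complete symplectic degenerate flag variety $\mathrm{Sp}\mathcal{F}l^a_{2m}$ be the set of $(V_i)\in\mathcal{F}l^a_{n+1}$ fixed by $\iota:(V_1,\dots,V_n)\mapsto(V_n^\perp,\dots,V_1^\perp)$. **Schubert side.** Let $W=\mathbb{C}^{2n}$ with basis $e_1,\dots,e_{2n}$ and the symplectic form $b_W$ with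 $b_W(e_k,e_{2n+1-k})=1$ for $1\le k\le n$, $b_W(e_k,e_{2n+1-k})=-1$ for $n<k\le 2n$, and $b_W(e_k,e_l)=0$ for $k+l\neq 2n+1$. Let $\mathrm{Sp}_{2n}\subset \mathrm{SL}_{2n}$ be the group of matrices in $\mathrm{SL}_{2n}(\mathbb{C})$ preserving $b_W$, $B\subset \mathrm{SL}_{2n}$ the upper triangular and $T\subset B$ the diagonal matrices, $B^\iota=B\cap \mathrm{Sp}_{2n}$, $T^\iota=T\cap \mathrm{Sp}_{2n}$. Let $P\subset\mathrm{SL}_{2n}$ be the stabilizer of the flag $(\langle e_1,\dots,e_{2i-1}\rangle)_{i=1}^n$ and $Q=P\cap \mathrm{Sp}_{2n}$. Identify $\mathrm{SL}_{2n}/P$ with the variety of flags $W_1\subset\dots\subset W_n\subset W$ with $\dim W_i=2i-1$, inside $\prod_{i=1}^n \mathrm{Gr}_{2i-1}(W)$, and $\mathrm{Sp}_{2n}/Q$ with the $\mathrm{Sp}_{2n}$-orbit of the flag above. Let $\iota$ act by $(W_1,\dots,W_n)\mapsto(W_n^\perp,\dots,W_1^\perp)$. Let $\sigma_n$ be the permutation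 of $\{1,\dots,2n\}$ with $\sigma_n(2k)=k$ for $1\le k\le n$ and $\sigma_n(2k+1)=n+1+k$ for $0\le k\le n-1$, let $F_{\sigma_n}$ be the flag with $i$-th member $\langle e_{\sigma_n(1)},\dots,e_{\sigma_n(2i-1)}\rangle$, let $X_{\sigma_n}=\overline{B\,F_{\sigma_n}}\subset \mathrm{SL}_{2n}/P$ be its Schubert variety (Zariski closure), and $X_{\sigma_n}^\iota$ the set of $\iota$-fixed points of $X_{\sigma_n}$. **Torus action.** $t=\mathrm{diag}(t_1,\dots,t_{2n})\in T^\iota$ acts on $\prod_i \mathrm{Gr}_{2i-1}(W)$ by $t\cdot e_k=t_ke_k$, and on the $i$-th factor of $\prod_i\mathrm{Gr}_i(V)$ through $f_k\mapsto t_kf_k$ if $i\le k\le n+1$ and $f_k\mapsto t_{n+1+k}f_k$ if $1\le k\le i-1$. **Theorem.** $\mathrm{Sp}\mathcal{F}l^a_{2m}$ is Zariski closed in $\prod_i\mathrm{Gr}_i(V)$ and stable under $T^\iota$. The fixed locus $X_{\sigma_n}^\iota$ is contained in $\mathrm{Sp}_{2n}/Q$ and is a Schubert variety there, namely $X_{\sigma_n}^\iota=\overline{B^\iota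 F_{\sigma_n}}$. There exists a $T^\iota$-equivariant isomorphism of projective varieties $$\zeta:\ \mathrm{Sp}\mathcal{F}l^a_{2m}\ \xrightarrow{\ \simeq\ }\ X_{\sigma_n}^\iota\subset \mathrm{Sp}_{2n}/Q .$$ -/

import Mathlib

noncomputable section

open Module MvPolynomial

namespace DegFlag

/-! ### Products of Grassmannians as projective varieties -/

/-- The Grassmannian `Gr_k(ℂ^N)` of `k`-dimensional linear subspaces of `ℂ^N`. -/
def Gr (k N : ℕ) : Type :=
  {U : Submodule ℂ (Fin N → ℂ) // finrank ℂ U = k}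

/-- The subspace which a point of the Grassmannian is. -/
def Gr.space {k N : ℕ} (U : Gr k N) : Submodule ℂ (Fin N → ℂ) := U.1

theorem Gr.ext {k N : ℕ} {U U' : Gr k N} (h : U.space = U'.space) : U = U' :=
  Subtype.ext h

/-- A linear automorphism of `ℂ^N` acts on `Gr_k(ℂ^N)` by `U ↦ f(U)`. -/
def Gr.map {k N : ℕ} (f : (Fin N → ℂ) ≃ₗ[ℂ] (Fin N → ℂ)) (U : Gr k N) : Gr k N :=
  ⟨U.space.map (f : (Fin N → ℂ) →ₗ[ℂ] (Fin N → ℂ)),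
    (LinearEquiv.finrank_map_eq f U.1).trans U.2⟩

/-- The product `∏ᵢ Gr_{d i}(ℂ^N)` of Grassmannians. -/
abbrev GrProd {s : ℕ} (N : ℕ) (d : Fin s → ℕ) : Type := ∀ i, Gr (d i) N

/-- Homogeneous Plücker coordinates of `U ∈ Gr_k(ℂ^N)`: the maximal minors, indexed by
`k`-element subsets of rows (increasing maps `Fin k → Fin N`), of the `N × k` matrix whose columns
form a basis of `U`.  A change of the basis multiplies them all by one nonzero scalar. -/
def Gr.plucker {k N : ℕ} (U : Gr k N) (I : Fin k ↪o Fin N) : ℂ :=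
  Matrix.det (Matrix.of fun a c : Fin k =>
    ((finBasisOfFinrankEq ℂ U.1 U.2 c : U.1) : Fin N → ℂ) (I a))

/-- The index set of all Plücker coordinates on `∏ᵢ Gr_{d i}(ℂ^N)`. -/
abbrev PluckerIndex {s : ℕ} (N : ℕ) (d : Fin s → ℕ) : Type := Σ i : Fin s, (Fin (d i) ↪o Fin N)

/-- The collection of homogeneous coordinates of a point of `∏ᵢ Gr_{d i}(ℂ^N)` in the product of
projective spaces `∏ᵢ ℙ(Λ^{d i} ℂ^N)`. -/
def coords {s N : ℕ} {d : Fin s → ℕ} (x : GrProd N d) : PluckerIndex N d → ℂ :=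
  fun p => (x p.1).plucker p.2

/-- `F` is a polynomial in the Plücker coordinates which, for every `i`, is homogeneous of degree
`e i` in the coordinates of the `i`-th factor. -/
def IsMultihomogeneous {s N : ℕ} {d : Fin s → ℕ} (F : MvPolynomial (PluckerIndex N d) ℂ)
    (e : Fin s → ℕ) : Prop :=
  IsWeightedHomogeneous (fun p : PluckerIndex N d => (Pi.single p.1 1 : Fin s → ℕ)) F e

/-- Zariski closed subsets of `∏ᵢ Gr_{d i}(ℂ^N)`: the common zero loci of families of
multihomogeneous polynomials in the Plücker coordinates. -/
def IsZariskiClosed {s N : ℕ} {d : Fin s → ℕ} (Z : Set (GrProd N d)) : Prop :=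
  ∃ S : Set (MvPolynomial (PluckerIndex N d) ℂ),
    (∀ F ∈ S, ∃ e, IsMultihomogeneous F e) ∧ Z = {x | ∀ F ∈ S, eval (coords x) F = 0}

/-- The Zariski closure in `∏ᵢ Gr_{d i}(ℂ^N)`. -/
def zariskiClosure {s N : ℕ} {d : Fin s → ℕ} (A : Set (GrProd N d)) : Set (GrProd N d) :=
  ⋂₀ {Z | IsZariskiClosed Z ∧ A ⊆ Z}

/-- Regular maps (morphisms of varieties) between subvarieties `X`, `Y` of products of
Grassmannians: around every point of `X` and for every factor `j` of the target, the homogeneous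
Plücker coordinates of the `j`-th component of the image are given by multihomogeneous polynomials
of the same multidegree in the homogeneous coordinates of the argument. -/
def IsRegularMap {s N s' N' : ℕ} {d : Fin s → ℕ} {d' : Fin s' → ℕ}
    {X : Set (GrProd N d)} {Y : Set (GrProd N' d')} (φ : X → Y) : Prop :=
  ∀ (x : X) (j : Fin s'), ∃ (e : Fin s → ℕ)
    (F : (Fin (d' j) ↪o Fin N') → MvPolynomial (PluckerIndex N d) ℂ),
    (∀ I, IsMultihomogeneous (F I) e) ∧
    (∃ I, eval (coords x.1) (F I) ≠ 0) ∧
    ∀ y : X, (∃ I, eval (coords y.1) (F I) ≠ 0) →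
      ∃ c : ℂ, c ≠ 0 ∧ ∀ I, eval (coords y.1) (F I) = c * ((φ y).1 j).plucker I

/-- A bijection which is regular in both directions. -/
def IsVarietyIso {s N s' N' : ℕ} {d : Fin s → ℕ} {d' : Fin s' → ℕ}
    {X : Set (GrProd N d)} {Y : Set (GrProd N' d')} (φ : X ≃ Y) : Prop :=
  IsRegularMap φ ∧ IsRegularMap φ.symm

/-- For a bilinear form `b`, the fixed points of the involution
`ι : (U_1, …, U_s) ↦ (U_s^⊥, …, U_1^⊥)`. -/
def iotaFixed {s N : ℕ} {d : Fin s → ℕ} (b : LinearMap.BilinForm ℂ (Fin N → ℂ)) :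
    Set (GrProd N d) :=
  {x | ∀ i, b.orthogonal (x (Fin.rev i)).space = (x i).space}

/-! ### The degenerate flag varieties

`V = ℂ^{n+1}` with standard basis `f_1, …, f_{n+1}`; the vector `f_k` has index `k - 1` in
`Fin (n + 1)`, and the `i`-th member of a tuple of subspaces has index `i - 1` in `Fin n`. -/

/-- The projection `pr` of `ℂ^N` along the line spanned by the `k`-th basis vector. -/
def pr {N : ℕ} (k : Fin N) : (Fin N → ℂ) →ₗ[ℂ] (Fin N → ℂ) :=
  LinearMap.pi fun l => if l = k then 0 else LinearMap.proj l

/-- The ambient product `∏_{i=1}^n Gr_i(ℂ^{n+1})`. -/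
abbrev AmbV (n : ℕ) : Type := GrProd (s := n) (n + 1) (fun i => (i : ℕ) + 1)

/-- The complete degenerate flag variety of type A: tuples `(V_1, …, V_n)` with `dim V_i = i` and
`pr_i V_i ⊆ V_{i+1}` for `1 ≤ i ≤ n - 1`. -/
def degFlag (n : ℕ) : Set (AmbV n) :=
  {x | ∀ (i j : Fin n), (j : ℕ) = i + 1 →
    (x i).space.map (pr (Fin.castSucc i)) ≤ (x j).space}

/-- The pairing `k ↔ k^*` of the indices of `f_1, …, f_{n+1}`, `n + 1 = 2m`: for one-based indices
`k^* = n - k` if `1 ≤ k ≤ n - 1`, `n^* = n + 1` and `(n + 1)^* = n`. -/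
def IsDualIndex {n : ℕ} (k l : Fin (n + 1)) : Prop :=
  (k : ℕ) + l + 2 = n ∨ ((k : ℕ) + 1 = n ∧ (l : ℕ) = n) ∨ ((k : ℕ) = n ∧ (l : ℕ) + 1 = n)

/-- The symplectic forms on `V = ℂ^{n+1}` used to define the symplectic degenerate flag variety:
nondegenerate, alternating, and `f_k^*` (up to a nonzero factor) is as prescribed above. -/
structure IsAdaptedForm {n : ℕ} (b : LinearMap.BilinForm ℂ (Fin (n + 1) → ℂ)) : Prop where
  isAlt : b.IsAlt
  nondegenerate : b.Nondegenerate
  eq_zero : ∀ k l : Fin (n + 1), ¬ IsDualIndex k l → b (Pi.single k 1) (Pi.single l 1) = 0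

/-- The complete symplectic degenerate flag variety: the `ι`-fixed points of the degenerate flag
variety of type A. -/
def spDegFlag {n : ℕ} (b : LinearMap.BilinForm ℂ (Fin (n + 1) → ℂ)) : Set (AmbV n) :=
  degFlag n ∩ iotaFixed b

/-! ### Flag varieties and Schubert varieties for `SL_{2n}` and `Sp_{2n}`

`W = ℂ^{2n}` with standard basis `e_1, …, e_{2n}`; the vector `e_k` has index `k - 1`. -/

/-- The group `SL_{2n}(ℂ)`. -/
abbrev SL (n : ℕ) : Type := Matrix.SpecialLinearGroup (Fin (2 * n)) ℂ

/-- The matrix `E` with blocks `0`, `J`, `-J`, `0`, where `J` is the antidiagonal unit matrix. -/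
def matE (n : ℕ) : Matrix (Fin (2 * n)) (Fin (2 * n)) ℂ :=
  Matrix.of fun k l => if k = Fin.rev l then (if (k : ℕ) < n then 1 else -1) else 0

/-- The symplectic form `b_W` on `W = ℂ^{2n}`. -/
def formW (n : ℕ) : LinearMap.BilinForm ℂ (Fin (2 * n) → ℂ) := Matrix.toBilin' (matE n)

/-- The group `Sp_{2n}` of the elements of `SL_{2n}` which preserve `b_W`. -/
def Sp (n : ℕ) : Subgroup (SL n) where
  carrier := {A | ∀ v w, formW n (Matrix.SpecialLinearGroup.toLin' A v)
    (Matrix.SpecialLinearGroup.toLin' A w) = formW n v w}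
  mul_mem' := by
    intro A B hA hB v w
    rw [map_mul, LinearEquiv.mul_apply, LinearEquiv.mul_apply, hA, hB]
  one_mem' := by
    intro v w
    simp
  inv_mem' := by
    intro A hA v w
    rw [← hA, ← LinearEquiv.mul_apply, ← LinearEquiv.mul_apply, ← map_mul]
    simp

/-- The ambient product `∏_{i=1}^n Gr_{2i-1}(ℂ^{2n})`. -/
abbrev AmbW (n : ℕ) : Type := GrProd (s := n) (2 * n) (fun i => 2 * (i : ℕ) + 1)

/-- `SL_{2n}` acts on every Grassmannian of `W`, hence on tuples of subspaces. -/
instance grAction (n k : ℕ) : MulAction (SL n) (Gr k (2 * n)) where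
  smul g U := U.map (Matrix.SpecialLinearGroup.toLin' g)
  one_smul U := by
    apply Gr.ext
    change U.space.map _ = U.space
    rw [map_one]
    exact Submodule.map_id _
  mul_smul g h U := by
    apply Gr.ext
    change U.space.map _ = (U.space.map _).map _
    rw [map_mul, ← Submodule.map_comp]
    rfl

/-- The coordinate flag of a permutation `τ`: its `i`-th member is the span of
`e_{τ(1)}, …, e_{τ(2i-1)}`. -/
def coordFlag {n : ℕ} (τ : Equiv.Perm (Fin (2 * n))) : AmbW n := fun i =>
  ⟨Submodule.span ℂ (Set.range fun r : Fin (2 * (i : ℕ) + 1) =>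
      (Pi.single (τ ⟨r, by omega⟩) 1 : Fin (2 * n) → ℂ)), by
    have h : LinearIndependent ℂ (fun r : Fin (2 * (i : ℕ) + 1) =>
        (Pi.single (τ ⟨r, by omega⟩) 1 : Fin (2 * n) → ℂ)) := by
      have h0 := (Pi.basisFun ℂ (Fin (2 * n))).linearIndependent.comp
        (fun r : Fin (2 * (i : ℕ) + 1) => τ ⟨r, by omega⟩) (by
          intro r r' hr
          have := τ.injective hr
          simpa [Fin.ext_iff] using this)
      convert h0 using 1
      funext r
      simp
    rw [finrank_span_eq_card h, Fintype.card_fin]⟩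

/-- The flag variety `SL_{2n}/P` as the set of all partial flags `W_1 ⊆ … ⊆ W_n` in `ℂ^{2n}` with
`dim W_i = 2i - 1`. -/
def flagVariety (n : ℕ) : Set (AmbW n) :=
  {x | ∀ i j : Fin n, i ≤ j → (x i).space ≤ (x j).space}

/-- The parabolic subgroup `P = P_{ω_1 + ω_3 + … + ω_{2n-1}}` of `SL_{2n}`: the stabilizer of the
standard flag with members `⟨e_1, …, e_{2i-1}⟩`. -/
def parabolicP (n : ℕ) : Subgroup (SL n) := MulAction.stabilizer (SL n) (coordFlag (n := n) 1)

/-- The parabolic subgroup `Q = P ∩ Sp_{2n}` of `Sp_{2n}`. -/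
def parabolicQ (n : ℕ) : Subgroup (Sp n) := (parabolicP n).subgroupOf (Sp n)

/-- The embedding of `Sp_{2n}/Q` into the product of Grassmannians which sends `gQ` to the image
of the standard flag under `g`. -/
def embQ (n : ℕ) : Sp n ⧸ parabolicQ n → AmbW n :=
  Quotient.lift (fun g : Sp n => (g : SL n) • coordFlag (n := n) 1) (by
    intro g h hgh
    have h1 : g⁻¹ * h ∈ parabolicQ n := QuotientGroup.leftRel_apply.mp hgh
    have h2 : ((g : SL n)⁻¹ * (h : SL n)) • coordFlag (n := n) 1 = coordFlag (n := n) 1 := h1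
    rw [mul_smul, inv_smul_eq_iff] at h2
    exact h2.symm)

/-- The Borel subgroup `B` of upper triangular matrices in `SL_{2n}`. -/
def borel (n : ℕ) : Set (SL n) := {g | ∀ k l : Fin (2 * n), l < k → g.1 k l = 0}

/-- The Schubert cell `B τ P / P`, realized as the `B`-orbit of the coordinate flag of `τ`. -/
def schubertCell {n : ℕ} (τ : Equiv.Perm (Fin (2 * n))) : Set (AmbW n) :=
  {x | ∃ g ∈ borel n, x = g • coordFlag τ}

/-- The Schubert variety `X_τ ⊆ SL_{2n}/P`, the Zariski closure of the Schubert cell. -/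
def schubertVariety {n : ℕ} (τ : Equiv.Perm (Fin (2 * n))) : Set (AmbW n) :=
  zariskiClosure (schubertCell τ)

/-- The Schubert cell `B^ι τ Q / Q` of `Sp_{2n}/Q`, where `B^ι = B ∩ Sp_{2n}`. -/
def spSchubertCell {n : ℕ} (τ : Equiv.Perm (Fin (2 * n))) : Set (AmbW n) :=
  {x | ∃ g ∈ borel n ∩ (Sp n : Set (SL n)), x = g • coordFlag τ}

/-- The Schubert variety of `Sp_{2n}/Q`, the Zariski closure of the cell `B^ι τ Q / Q`. -/
def spSchubertVariety {n : ℕ} (τ : Equiv.Perm (Fin (2 * n))) : Set (AmbW n) :=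
  zariskiClosure (spSchubertCell τ)

/-- The permutation `σ_n`; for one-based arguments `σ_n(2k) = k` and `σ_n(2k+1) = n + 1 + k`. -/
def sigma (n : ℕ) : Equiv.Perm (Fin (2 * n)) where
  toFun r := if (r : ℕ) % 2 = 1 then ⟨r / 2, by omega⟩ else ⟨n + r / 2, by omega⟩
  invFun k := if h : (k : ℕ) < n then ⟨2 * k + 1, by omega⟩ else ⟨2 * (k - n), by omega⟩
  left_inv r := by
    by_cases h : (r : ℕ) % 2 = 1
    · have h1 : (r : ℕ) / 2 < n := by omega
      apply Fin.ext
      simp only [h, if_true, h1, dif_pos]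
      omega
    · have h1 : ¬ n + (r : ℕ) / 2 < n := by omega
      apply Fin.ext
      simp only [h, if_false, h1, dif_neg, not_false_iff]
      omega
  right_inv k := by
    by_cases h : (k : ℕ) < n
    · have h1 : (2 * (k : ℕ) + 1) % 2 = 1 := by omega
      apply Fin.ext
      simp only [h, dif_pos, h1, if_true]
      omega
    · have h1 : ¬ (2 * ((k : ℕ) - n)) % 2 = 1 := by omega
      apply Fin.ext
      simp only [h, dif_neg, not_false_iff, h1, if_false]
      omega

/-! ### The torus actions -/

/-- The diagonal automorphism of `ℂ^N` with eigenvalues `c_1, …, c_N`. -/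
def diagAut {N : ℕ} (c : Fin N → ℂˣ) : (Fin N → ℂ) ≃ₗ[ℂ] (Fin N → ℂ) :=
  LinearEquiv.piCongrRight fun k => LinearEquiv.smulOfUnit (c k)

/-- The torus `T^ι = T ∩ Sp_{2n}`: diagonal matrices `diag(t_1, …, t_{2n})` of determinant one
which preserve `b_W`. -/
def torusIota (n : ℕ) : Set (Fin (2 * n) → ℂˣ) :=
  {t | ∏ k, t k = 1 ∧ ∀ v w, formW n (diagAut t v) (diagAut t w) = formW n v w}

/-- The action of the torus on tuples of subspaces of `W`, `t · e_k = t_k e_k`. -/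
def torusActW {n : ℕ} (t : Fin (2 * n) → ℂˣ) (x : AmbW n) : AmbW n :=
  fun i => (x i).map (diagAut t)

/-- The weights of the torus on the `i`-th copy of `V`: in one-based indices, `f_k` is multiplied
by `t_k` if `i ≤ k ≤ n + 1`, and by `t_{n+1+k}` if `1 ≤ k ≤ i - 1`. -/
def weightV {n : ℕ} (t : Fin (2 * n) → ℂˣ) (i : Fin n) : Fin (n + 1) → ℂˣ := fun k =>
  if h : (i : ℕ) ≤ k then t ⟨k, by omega⟩ else t ⟨n + 1 + k, by omega⟩

/-- The action of the torus on tuples of subspaces of `V`. -/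
def torusActV {n : ℕ} (t : Fin (2 * n) → ℂˣ) (x : AmbV n) : AmbV n :=
  fun i => (x i).map (diagAut (weightV t i))

end DegFlag

end

noncomputable section

open Module MvPolynomial

namespace DegFlag

/-! A cyclic shift of indices identifies the `i`-th copy of `V` with the window `⟨e_i, …, e_{n+i}⟩`
of `W`, and `V_i` goes to `W_i = ⟨e_1, …, e_{i-1}⟩ ⊕ π_i(V_i)`. Every subspace of dimension `2i-1`
between `⟨e_1, …, e_{i-1}⟩` and `⟨e_1, …, e_{n+i}⟩` arises in this way from exactly one `V_i`
(`exists_zeta_eq`, `zeta_injective`). Passing to the next window exchanges `e_i` for `e_{n+1+i}`,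
and both stand for `f_i`. Hence `pr_i`, which kills `f_i`, becomes the inclusion modulo `⟨e_1, …,
e_i⟩`, and the degenerate relations become `W_i ⊆ W_{i+1}` (`zeta_mem_flagVariety_iff`). The windows
of `i` and `n+1-i` are exchanged by `q ↦ 2n+1-q`. After rescaling the basis of `W`, the pairing of
these windows under `b_W` is the given form `b_V` (`IsAdaptedForm.formW_winMap`), so the map
respects `ι`. It is torus equivariant, and minors of `V_i` and of `W_i` determine each other
linearly, so it is an isomorphism onto the `ι`-fixed `boundedFlags`.

It remains to recognise these flags as a Schubert variety. The bounds are closed and `B`-stable and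
hold for the flag of `σ_n`, so they hold on `X_{σ_n}`. This gives the inclusions `spSchubertVariety
⊆ X_{σ_n}^ι ⊆ boundedFlags ∩ iotaFixed`, and it suffices to show that the last set lies in the
first; a description of `X_{σ_n}` itself is not needed. A symplectic Gaussian elimination conjugates
each `ι`-fixed flag by `B^ι` to a coordinate flag of a self-dual permutation
(`exists_spBorel_smul_eq_coordFlag`).

If such a flag satisfies the bounds and is not that of `σ_n`, a counting argument gives a reflection
which moves it towards `σ_n` within the bounds (`exists_raising_pair`). A curve in a root subgroup
exhibits the old flag as a limit of points in the `B^ι`-orbit of the reflected one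
(`exists_rootSL_smul_eq`, `mem_of_curve`), and induction on a weighted sum of heights finishes. The
same reflections, used in the other direction, show that all these flags lie in one `Sp_{2n}`-orbit.
-/

/-! ### Minors, frames and Plücker coordinates -/

/-- The minor of the matrix with columns `v` on the rows `g a`, as an alternating function of the
columns. -/
def minor {k N : ℕ} (g : Fin k → Fin N) : (Fin N → ℂ) [⋀^Fin k]→ₗ[ℂ] ℂ :=
  (Matrix.detRowAlternating (R := ℂ) (n := Fin k)).compLinearMap (LinearMap.funLeft ℂ ℂ g)

theorem minor_apply {k N : ℕ} (g : Fin k → Fin N) (v : Fin k → Fin N → ℂ) :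
    minor g v = Matrix.det (Matrix.of fun a c : Fin k => v c (g a)) := by
  rw [← Matrix.det_transpose]
  rfl

/-- The chosen basis of a point of the Grassmannian. -/
def Gr.frame {k N : ℕ} (U : Gr k N) : Fin k → Fin N → ℂ :=
  fun c => (finBasisOfFinrankEq ℂ U.1 U.2 c : U.1)

theorem Gr.plucker_eq {k N : ℕ} (U : Gr k N) (I : Fin k ↪o Fin N) :
    U.plucker I = minor I U.frame := (minor_apply _ _).symm

theorem Gr.span_frame {k N : ℕ} (U : Gr k N) :
    Submodule.span ℂ (Set.range U.frame) = U.space := by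
  have h := (finBasisOfFinrankEq ℂ U.1 U.2).span_eq
  have h2 := congrArg (Submodule.map U.1.subtype) h
  rw [Submodule.map_span, Submodule.map_top, Submodule.range_subtype, ← Set.range_comp] at h2
  exact h2

/-- An increasing map is determined by its range, so if `J ≠ I`, some value of `I` is missed by `J`
and the corresponding column vanishes. -/
theorem minor_single {k N : ℕ} (I J : Fin k ↪o Fin N) :
    minor (J : Fin k → Fin N) (fun c => Pi.single (I c) 1) = if J = I then 1 else 0 := by
  rw [minor_apply]
  split_ifs with h
  · subst h
    convert Matrix.det_one (n := Fin k) (R := ℂ) using 2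
    ext a c
    simp [Matrix.one_apply, Pi.single_apply]
  · obtain ⟨c, hc⟩ : ∃ c, ∀ a, J a ≠ I c := by
      by_contra! hcon
      apply h
      have hr : Set.range J = Set.range I := by
        symm
        apply Set.eq_of_subset_of_card_le
        · rintro _ ⟨c, rfl⟩
          obtain ⟨a, ha⟩ := hcon c
          exact ⟨a, ha⟩
        · rw [Set.card_range_of_injective J.injective, Set.card_range_of_injective I.injective]
      exact DFunLike.coe_injective
        (StrictMono.range_inj (f := (J : Fin k → Fin N)) J.strictMono I.strictMono |>.1 hr)
    apply Matrix.det_eq_zero_of_column_eq_zero c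
    intro a
    simp [Pi.single_apply, hc a]

/-- An alternating function is a linear combination of the maximal minors. -/
theorem alternating_eq_sum_minor {k N : ℕ} (f : (Fin N → ℂ) [⋀^Fin k]→ₗ[ℂ] ℂ)
    (v : Fin k → Fin N → ℂ) :
    f v = ∑ J : Fin k ↪o Fin N, f (fun c => Pi.single (J c) 1) * minor J v := by
  let f' : (Fin N → ℂ) [⋀^Fin k]→ₗ[ℂ] ℂ :=
    ∑ J : Fin k ↪o Fin N, f (fun c => Pi.single (J c) 1) • minor J
  have hf' : ∀ v, f' v = ∑ J : Fin k ↪o Fin N, f (fun c => Pi.single (J c) 1) * minor J v := by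
    intro v
    let ev : ((Fin N → ℂ) [⋀^Fin k]→ₗ[ℂ] ℂ) →+ ℂ :=
      { toFun := fun F => F v, map_zero' := rfl, map_add' := fun _ _ => rfl }
    exact map_sum ev _ _
  rw [← hf']
  congr 1
  refine Module.Basis.ext_alternating (Pi.basisFun ℂ (Fin N)) fun g hg => ?_
  have hmono : ∀ I : Fin k ↪o Fin N, f (fun c => Pi.single (I c) 1) =
      f' (fun c => Pi.single (I c) 1) := by
    intro I
    rw [hf', Finset.sum_eq_single I]
    · simp [minor_single]
    · intro J _ hJ
      rw [minor_single, if_neg hJ, mul_zero]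
    · simp
  -- Sorting an injective index family changes both sides by the same sign, which reduces the
  -- comparison to increasing families.
  have hsort : StrictMono (g ∘ Tuple.sort g) :=
    (Tuple.monotone_sort g).strictMono_of_injective (hg.comp (Tuple.sort g).injective)
  have h1 := hmono (OrderEmbedding.ofStrictMono _ hsort)
  have h2 : (fun c => (Pi.single ((OrderEmbedding.ofStrictMono _ hsort) c) 1 : Fin N → ℂ)) =
      (fun c => Pi.basisFun ℂ (Fin N) (g c)) ∘ Tuple.sort g := by
    funext c
    simp
  rw [h2, AlternatingMap.map_perm, AlternatingMap.map_perm] at h1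
  exact smul_left_cancel _ h1

/-- Two spanning families of the same space have proportional alternating functions. -/
theorem exists_scalar_of_span_eq {k N : ℕ} (U : Gr k N) (v : Fin k → Fin N → ℂ)
    (hv : Submodule.span ℂ (Set.range v) = U.space) :
    ∃ c : ℂ, c ≠ 0 ∧ ∀ f : (Fin N → ℂ) [⋀^Fin k]→ₗ[ℂ] ℂ, f v = c * f U.frame := by
  let b := finBasisOfFinrankEq ℂ U.1 U.2
  have hmem : ∀ c, v c ∈ U.1 := fun c => by
    change v c ∈ U.space
    rw [← hv]
    exact Submodule.subset_span ⟨c, rfl⟩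
  let w : Fin k → U.1 := fun c => ⟨v c, hmem c⟩
  have hw : ⊤ ≤ Submodule.span ℂ (Set.range w) := by
    rw [← Submodule.map_le_map_iff_of_injective U.1.subtype_injective, Submodule.map_span,
      Submodule.map_top, Submodule.range_subtype, ← Set.range_comp]
    exact hv.ge
  have hli : LinearIndependent ℂ w :=
    linearIndependent_of_top_le_span_of_card_eq_finrank hw (by rw [U.2, Fintype.card_fin])
  refine ⟨b.det w, (b.isUnit_det (Basis.mk hli hw) |> fun h => by
    simpa using h.ne_zero), fun f => ?_⟩
  have h := AlternatingMap.eq_smul_basis_det b (f.compLinearMap U.1.subtype)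
  have h2 := congrArg (fun F => F w) h
  simp only [AlternatingMap.smul_apply, AlternatingMap.compLinearMap_apply, smul_eq_mul] at h2
  rw [mul_comm]
  exact h2

/-- Projecting to `U` and taking the determinant in its basis gives an alternating function on the
whole space that does not vanish on a basis of `U`. Since it is a combination of minors, they cannot
all vanish. -/
theorem minor_frame_ne_zero {k N : ℕ} (U : Gr k N) (v : Fin k → Fin N → ℂ)
    (hv : Submodule.span ℂ (Set.range v) = U.space) :
    ∃ I : Fin k ↪o Fin N, minor I v ≠ 0 := by
  by_contra! hcon
  obtain ⟨c, hc, hcf⟩ := exists_scalar_of_span_eq U v hv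
  obtain ⟨p, hp⟩ := U.1.exists_isCompl
  let pr := U.1.projectionOnto p hp
  let b := finBasisOfFinrankEq ℂ U.1 U.2
  let f : (Fin N → ℂ) [⋀^Fin k]→ₗ[ℂ] ℂ := b.det.compLinearMap pr
  have h1 : f U.frame = 1 := by
    have : (fun c => pr (U.frame c)) = b := by
      funext c
      exact Submodule.projectionOnto_apply_left hp (b c)
    change b.det (fun c => pr (U.frame c)) = 1
    rw [this, b.det_self]
  have h2 := alternating_eq_sum_minor f v
  rw [hcf, h1, mul_one] at h2
  exact hc (by rw [h2]; exact Finset.sum_eq_zero fun J _ => by rw [hcon, mul_zero])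

theorem Gr.exists_plucker_ne_zero {k N : ℕ} (U : Gr k N) : ∃ I, U.plucker I ≠ 0 := by
  simp_rw [U.plucker_eq]
  exact minor_frame_ne_zero U _ U.span_frame

/-! ### Alternating functions as multihomogeneous polynomials -/

/-- An alternating function of a basis of the `i`-th member, as a linear polynomial in the Plücker
coordinates. -/
def altPoly {s N : ℕ} {d : Fin s → ℕ} (i : Fin s) (f : (Fin N → ℂ) [⋀^Fin (d i)]→ₗ[ℂ] ℂ) :
    MvPolynomial (PluckerIndex N d) ℂ :=
  ∑ J : Fin (d i) ↪o Fin N, C (f (fun c => Pi.single (J c) 1)) * X ⟨i, J⟩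

theorem isMultihomogeneous_sum {s N : ℕ} {d : Fin s → ℕ} {ι : Type*} (t : Finset ι)
    (F : ι → MvPolynomial (PluckerIndex N d) ℂ) (e : Fin s → ℕ)
    (h : ∀ i ∈ t, IsMultihomogeneous (F i) e) : IsMultihomogeneous (∑ i ∈ t, F i) e :=
  (weightedHomogeneousSubmodule ℂ _ e).sum_mem h

theorem isMultihomogeneous_altPoly {s N : ℕ} {d : Fin s → ℕ} (i : Fin s)
    (f : (Fin N → ℂ) [⋀^Fin (d i)]→ₗ[ℂ] ℂ) :
    IsMultihomogeneous (altPoly i f) (Pi.single i 1) :=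
  isMultihomogeneous_sum _ _ _ fun J _ =>
    (isWeightedHomogeneous_X ℂ _ (⟨i, J⟩ : PluckerIndex N d)).C_mul _

theorem eval_altPoly {s N : ℕ} {d : Fin s → ℕ} (i : Fin s)
    (f : (Fin N → ℂ) [⋀^Fin (d i)]→ₗ[ℂ] ℂ) (x : GrProd N d) :
    eval (coords x) (altPoly i f) = f (x i).frame := by
  rw [alternating_eq_sum_minor f (x i).frame, altPoly, map_sum]
  refine Finset.sum_congr rfl fun J _ => ?_
  rw [map_mul, eval_C, eval_X]
  change _ * (x i).plucker J = _
  rw [Gr.plucker_eq]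

/-- Multihomogeneous polynomials rescale when the coordinates of every factor are rescaled. -/
theorem IsMultihomogeneous.eval_smul {s N : ℕ} {d : Fin s → ℕ}
    {F : MvPolynomial (PluckerIndex N d) ℂ} {e : Fin s → ℕ} (hF : IsMultihomogeneous F e)
    (c : Fin s → ℂ) (p : PluckerIndex N d → ℂ) :
    eval (fun q => c q.1 * p q) F = (∏ i, c i ^ e i) * eval p F := by
  classical
  rw [eval_eq, eval_eq, Finset.mul_sum]
  refine Finset.sum_congr rfl fun m hm => ?_
  have hw := hF (mem_support_iff.1 hm)
  have : ∏ i, c i ^ e i = ∏ q ∈ m.support, c q.1 ^ m q := by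
    have he : ∀ i, e i = ∑ q ∈ m.support, if q.1 = i then m q else 0 := by
      intro i
      rw [← hw, Finsupp.weight_apply, Finsupp.sum, Finset.sum_apply]
      refine Finset.sum_congr rfl fun q _ => ?_
      simp [Pi.single_apply, eq_comm]
    simp_rw [he, ← Finset.prod_pow_eq_pow_sum]
    rw [Finset.prod_comm]
    refine Finset.prod_congr rfl fun q _ => ?_
    rw [Finset.prod_eq_single q.1]
    · simp
    · intro i _ hi
      simp [Ne.symm hi]
    · simp
  simp_rw [mul_pow]
  rw [Finset.prod_mul_distrib, this]
  ring

/-- A multihomogeneous polynomial may be tested on arbitrary bases. -/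
theorem IsMultihomogeneous.eval_eq_zero_iff {s N : ℕ} {d : Fin s → ℕ}
    {F : MvPolynomial (PluckerIndex N d) ℂ} {e : Fin s → ℕ} (hF : IsMultihomogeneous F e)
    (x : GrProd N d) (v : ∀ i, Fin (d i) → Fin N → ℂ)
    (hv : ∀ i, Submodule.span ℂ (Set.range (v i)) = (x i).space) :
    eval (fun q : PluckerIndex N d => minor q.2 (v q.1)) F = 0 ↔ eval (coords x) F = 0 := by
  choose c hc hcf using fun i => exists_scalar_of_span_eq (x i) (v i) (hv i)
  have : (fun q : PluckerIndex N d => minor q.2 (v q.1)) = fun q => c q.1 * coords x q := by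
    funext q
    rw [hcf]
    congr 1
    exact ((x q.1).plucker_eq q.2).symm
  rw [this, hF.eval_smul, mul_eq_zero, or_iff_right]
  exact Finset.prod_ne_zero_iff.2 fun i _ => pow_ne_zero _ (hc i)

/-- A map whose components are given by alternating functions of a basis of one component of the
argument is regular. -/
theorem isRegularMap_of_alternating {s N s' N' : ℕ} {d : Fin s → ℕ} {d' : Fin s' → ℕ}
    {X : Set (GrProd N d)} {Y : Set (GrProd N' d')} (φ : X → Y) (i : Fin s' → Fin s)
    (f : ∀ j, (Fin (d' j) ↪o Fin N') → (Fin N → ℂ) [⋀^Fin (d (i j))]→ₗ[ℂ] ℂ)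
    (h : ∀ (x : X) (j : Fin s'), ∃ c : ℂ, c ≠ 0 ∧
      ∀ I, f j I (x.1 (i j)).frame = c * ((φ x).1 j).plucker I) : IsRegularMap φ := by
  intro x j
  refine ⟨Pi.single (i j) 1, fun I => altPoly (i j) (f j I),
    fun I => isMultihomogeneous_altPoly _ _, ?_, ?_⟩
  · obtain ⟨c, hc, hI⟩ := h x j
    obtain ⟨I, hI2⟩ := ((φ x).1 j).exists_plucker_ne_zero
    refine ⟨I, ?_⟩
    rw [eval_altPoly, hI]
    exact mul_ne_zero hc hI2
  · intro y _
    obtain ⟨c, hc, hI⟩ := h y j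
    exact ⟨c, hc, fun I => by rw [eval_altPoly, hI]⟩


/-! ### Zariski closed conditions -/

/-- The contraction of the exterior product of the `v c` by all rows `g` but the `a`-th. -/
def polar {k N : ℕ} (v : Fin k → Fin N → ℂ) (g : Fin k → Fin N) (a : Fin k) : Fin N → ℂ :=
  fun r => minor (Function.update g a r) v

theorem polar_eq_cramer {k N : ℕ} (v : Fin k → Fin N → ℂ) (g : Fin k → Fin N) (a : Fin k)
    (r : Fin N) :
    polar v g a r = Matrix.cramer (Matrix.of fun c a => v c (g a)) (fun c => v c r) a := by
  rw [polar, minor_apply,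
    ← Matrix.transpose_transpose (Matrix.of fun c a => v c (g a)), Matrix.cramer_transpose_apply]
  congr 1
  ext a' c
  by_cases h : a' = a
  · subst h
    simp
  · simp [h]

theorem polar_mem {k N : ℕ} (v : Fin k → Fin N → ℂ) (g : Fin k → Fin N) (a : Fin k) :
    polar v g a ∈ Submodule.span ℂ (Set.range v) := by
  have : polar v g a =
      ∑ c, (Matrix.adjugate (Matrix.of fun c a => v c (g a))) a c • v c := by
    funext r
    rw [polar_eq_cramer, Matrix.cramer_eq_adjugate_mulVec]
    simp [Matrix.mulVec, dotProduct, Finset.sum_apply]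
  rw [this]
  exact Submodule.sum_mem _ fun c _ => Submodule.smul_mem _ _ (Submodule.subset_span ⟨c, rfl⟩)

/-- This is Cramer's rule when `w` is one of the `v c`, and both sides are linear in `w`. It writes
a vector of the span through contractions, whose coordinates are minors and therefore polynomial on
the Grassmannian. -/
theorem sum_polar {k N : ℕ} (v : Fin k → Fin N → ℂ) (g : Fin k → Fin N) (w : Fin N → ℂ)
    (hw : w ∈ Submodule.span ℂ (Set.range v)) :
    ∑ a, w (g a) • polar v g a = minor g v • w := by
  induction hw using Submodule.span_induction with
  | mem x hx =>
    obtain ⟨c, rfl⟩ := hx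
    funext r
    have h := congrFun (Matrix.mulVec_cramer (Matrix.of fun c a => v c (g a)) (fun c => v c r)) c
    rw [Matrix.mulVec, dotProduct] at h
    simp only [← polar_eq_cramer, Matrix.of_apply, Pi.smul_apply, smul_eq_mul] at h
    simp only [Finset.sum_apply, Pi.smul_apply, smul_eq_mul]
    rw [h]
    rfl
  | zero => simp
  | add x y _ _ hx hy => simp [add_smul, Finset.sum_add_distrib, hx, hy]
  | smul c x _ hx =>
    rw [smul_comm, ← hx, Finset.smul_sum]
    exact Finset.sum_congr rfl fun a _ => by rw [Pi.smul_apply, smul_assoc]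

/-- The equation for a single `g` with nonzero minor already expresses `w` through elements of `U`.
All `g` are listed because no fixed minor is nonzero on the whole Grassmannian. -/
theorem Gr.mem_iff_polar {k N : ℕ} (U : Gr k N) (w : Fin N → ℂ) :
    w ∈ U.space ↔ ∀ g : Fin k → Fin N,
      minor g U.frame • w - ∑ a, w (g a) • polar U.frame g a = 0 := by
  constructor
  · intro h g
    rw [← U.span_frame] at h
    rw [sum_polar _ _ _ h, sub_self]
  · intro h
    obtain ⟨I, hI⟩ := minor_frame_ne_zero U _ U.span_frame
    have h1 := sub_eq_zero.1 (h I)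
    rw [← Submodule.smul_mem_iff _ hI, h1, ← U.span_frame]
    exact Submodule.sum_mem _ fun a _ => Submodule.smul_mem _ _ (polar_mem _ _ _)

theorem Gr.space_le_iff_polar {k N : ℕ} (U : Gr k N) (P : Submodule ℂ (Fin N → ℂ)) :
    U.space ≤ P ↔ ∀ (g : Fin k → Fin N) (a : Fin k), polar U.frame g a ∈ P := by
  constructor
  · intro h g a
    apply h
    rw [← U.span_frame]
    exact polar_mem _ _ _
  · intro h w hw
    obtain ⟨I, hI⟩ := minor_frame_ne_zero U _ U.span_frame
    rw [← Submodule.smul_mem_iff _ hI]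
    rw [← U.span_frame] at hw
    rw [← sum_polar _ _ _ hw]
    exact Submodule.sum_mem _ fun a _ => Submodule.smul_mem _ _ (h _ _)

section

variable {s N : ℕ} {d : Fin s → ℕ}

theorem isZariskiClosed_of_family {ι : Type*} {Z : Set (GrProd N d)}
    (F : ι → MvPolynomial (PluckerIndex N d) ℂ) (e : Fin s → ℕ)
    (hF : ∀ i, IsMultihomogeneous (F i) e)
    (hZ : ∀ x, x ∈ Z ↔ ∀ i, eval (coords x) (F i) = 0) : IsZariskiClosed Z := by
  refine ⟨Set.range F, ?_, ?_⟩
  · rintro _ ⟨i, rfl⟩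
    exact ⟨e, hF i⟩
  · ext x
    simp [hZ]

theorem IsZariskiClosed.iInter {ι : Sort*} {Z : ι → Set (GrProd N d)}
    (h : ∀ i, IsZariskiClosed (Z i)) : IsZariskiClosed (⋂ i, Z i) := by
  choose S hS hZ using h
  refine ⟨⋃ i, S i, ?_, ?_⟩
  · intro F hF
    obtain ⟨i, hi⟩ := Set.mem_iUnion.1 hF
    exact hS i F hi
  · ext x
    simp only [hZ, Set.mem_iInter, Set.mem_ofPred_eq, Set.mem_iUnion]
    exact ⟨fun h F ⟨i, hi⟩ => h i F hi, fun h i F hi => h F ⟨i, hi⟩⟩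

theorem IsZariskiClosed.inter {Z Z' : Set (GrProd N d)} (h : IsZariskiClosed Z)
    (h' : IsZariskiClosed Z') : IsZariskiClosed (Z ∩ Z') := by
  rw [Set.inter_eq_iInter]
  exact IsZariskiClosed.iInter (by rintro (_ | _) <;> assumption)

theorem zariskiClosure_subset {A Z : Set (GrProd N d)} (hZ : IsZariskiClosed Z) (h : A ⊆ Z) :
    zariskiClosure A ⊆ Z :=
  Set.sInter_subset_of_mem ⟨hZ, h⟩

theorem zariskiClosure_mono {A A' : Set (GrProd N d)} (h : A ⊆ A') :
    zariskiClosure A ⊆ zariskiClosure A' :=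
  Set.sInter_subset_sInter fun _ hZ => ⟨hZ.1, h.trans hZ.2⟩

theorem subset_zariskiClosure (A : Set (GrProd N d)) : A ⊆ zariskiClosure A :=
  Set.subset_sInter fun _ hZ => hZ.2

theorem isMultihomogeneous_mul_C_altPoly (i : Fin s) (c : ℂ)
    (f : (Fin N → ℂ) [⋀^Fin (d i)]→ₗ[ℂ] ℂ) :
    IsMultihomogeneous (C c * altPoly i f) (Pi.single i 1) :=
  (isMultihomogeneous_altPoly i f).C_mul c

/-- Containment of a fixed vector in the `i`-th member is a closed condition. -/
theorem isZariskiClosed_mem (i : Fin s) (w : Fin N → ℂ) :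
    IsZariskiClosed {x : GrProd N d | w ∈ (x i).space} := by
  refine isZariskiClosed_of_family (ι := (Fin (d i) → Fin N) × Fin N)
    (fun p => C (w p.2) * altPoly i (minor p.1) -
      ∑ a, C (w (p.1 a)) * altPoly i (minor (Function.update p.1 a p.2)))
    (Pi.single i 1) (fun p => ?_) (fun x => ?_)
  · exact IsWeightedHomogeneous.sub (isMultihomogeneous_mul_C_altPoly _ _ _)
      (isMultihomogeneous_sum _ _ _ fun a _ => isMultihomogeneous_mul_C_altPoly _ _ _)
  · rw [Set.mem_ofPred_eq, Gr.mem_iff_polar, Prod.forall]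
    refine forall_congr' fun g => ?_
    rw [funext_iff]
    refine forall_congr' fun r => ?_
    simp only [map_sub, map_mul, map_sum, eval_C, eval_altPoly, Pi.sub_apply, Pi.smul_apply,
      Finset.sum_apply, smul_eq_mul, Pi.zero_apply, polar]
    rw [mul_comm]

/-- Vanishing of a fixed linear functional on the `i`-th member is a closed condition. -/
theorem isZariskiClosed_le_ker (i : Fin s) (q : Fin N) :
    IsZariskiClosed {x : GrProd N d | ∀ w ∈ (x i).space, w q = 0} := by
  refine isZariskiClosed_of_family (ι := (Fin (d i) → Fin N) × Fin (d i))
    (fun p => altPoly i (minor (Function.update p.1 p.2 q)))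
    (Pi.single i 1) (fun p => isMultihomogeneous_altPoly _ _) (fun x => ?_)
  rw [Prod.forall]
  simp only [eval_altPoly]
  exact (x i).space_le_iff_polar (LinearMap.ker (LinearMap.proj q : (Fin N → ℂ) →ₗ[ℂ] ℂ))

/-- The `r`-th coordinate of the image of a contraction under a linear map. -/
def imgPoly (A : (Fin N → ℂ) →ₗ[ℂ] (Fin N → ℂ)) (i : Fin s) (g : Fin (d i) → Fin N)
    (a : Fin (d i)) (r : Fin N) : MvPolynomial (PluckerIndex N d) ℂ :=
  ∑ q, C (A (Pi.single q 1) r) * altPoly i (minor (Function.update g a q))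

theorem isMultihomogeneous_imgPoly (A : (Fin N → ℂ) →ₗ[ℂ] (Fin N → ℂ)) (i : Fin s)
    (g : Fin (d i) → Fin N) (a : Fin (d i)) (r : Fin N) :
    IsMultihomogeneous (imgPoly A i g a r) (Pi.single i 1) :=
  isMultihomogeneous_sum _ _ _ fun _ _ => isMultihomogeneous_mul_C_altPoly _ _ _

theorem eval_imgPoly (A : (Fin N → ℂ) →ₗ[ℂ] (Fin N → ℂ)) (i : Fin s)
    (g : Fin (d i) → Fin N) (a : Fin (d i)) (r : Fin N) (x : GrProd N d) :
    eval (coords x) (imgPoly A i g a r) = A (polar (x i).frame g a) r := by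
  conv_rhs => rw [← LinearMap.sum_single_apply _ (polar (x i).frame g a)]
  simp only [imgPoly, map_sum, map_mul, eval_C, eval_altPoly, Finset.sum_apply]
  refine Finset.sum_congr rfl fun q _ => ?_
  rw [show (Pi.single q (polar (x i).frame g a q) : Fin N → ℂ) =
    polar (x i).frame g a q • Pi.single q 1 by ext; simp [Pi.single_apply], map_smul,
    Pi.smul_apply, smul_eq_mul, mul_comm]
  rfl

/-- `A (U_i) ⊆ U_j` is a closed condition. -/
theorem isZariskiClosed_map_le (A : (Fin N → ℂ) →ₗ[ℂ] (Fin N → ℂ)) (i j : Fin s) :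
    IsZariskiClosed {x : GrProd N d | (x i).space.map A ≤ (x j).space} := by
  refine isZariskiClosed_of_family
    (ι := ((Fin (d i) → Fin N) × Fin (d i)) × ((Fin (d j) → Fin N) × Fin N))
    (fun p => altPoly j (minor p.2.1) * imgPoly A i p.1.1 p.1.2 p.2.2 -
      ∑ a, altPoly j (minor (Function.update p.2.1 a p.2.2)) *
        imgPoly A i p.1.1 p.1.2 (p.2.1 a))
    (Pi.single j 1 + Pi.single i 1) (fun p => ?_) (fun x => ?_)
  · exact IsWeightedHomogeneous.sub
      ((isMultihomogeneous_altPoly _ _).mul (isMultihomogeneous_imgPoly _ _ _ _ _))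
      (isMultihomogeneous_sum _ _ _ fun a _ =>
        (isMultihomogeneous_altPoly _ _).mul (isMultihomogeneous_imgPoly _ _ _ _ _))
  · rw [Set.mem_ofPred_eq, Submodule.map_le_iff_le_comap, Gr.space_le_iff_polar]
    simp only [Prod.forall]
    refine forall_congr' fun g => forall_congr' fun a => ?_
    rw [Submodule.mem_comap, Gr.mem_iff_polar]
    refine forall_congr' fun h => ?_
    rw [funext_iff]
    refine forall_congr' fun r => ?_
    simp only [map_sub, map_mul, map_sum, eval_imgPoly, eval_altPoly, Pi.sub_apply, Pi.smul_apply,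
      Finset.sum_apply, smul_eq_mul, Pi.zero_apply]
    simp only [polar, mul_comm]

/-- `b (U_i, U_j) = 0` is a closed condition. -/
theorem isZariskiClosed_le_orthogonal (b : LinearMap.BilinForm ℂ (Fin N → ℂ)) (i j : Fin s) :
    IsZariskiClosed {x : GrProd N d | (x i).space ≤ b.orthogonal (x j).space} := by
  refine isZariskiClosed_of_family
    (ι := ((Fin (d i) → Fin N) × Fin (d i)) × ((Fin (d j) → Fin N) × Fin (d j)))
    (fun p => ∑ r, altPoly j (minor (Function.update p.2.1 p.2.2 r)) *
        imgPoly (LinearMap.toMatrix₂' ℂ b).toLin' i p.1.1 p.1.2 r)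
    (Pi.single j 1 + Pi.single i 1) (fun p => ?_) (fun x => ?_)
  · exact isMultihomogeneous_sum _ _ _ fun a _ =>
        (isMultihomogeneous_altPoly _ _).mul (isMultihomogeneous_imgPoly _ _ _ _ _)
  · rw [Set.mem_ofPred_eq, Gr.space_le_iff_polar]
    simp only [Prod.forall]
    refine forall_congr' fun g => forall_congr' fun a => ?_
    have h := (x j).space_le_iff_polar (LinearMap.ker (b.flip (polar (x i).frame g a)))
    refine Iff.trans ?_ (h.trans ?_)
    · rfl
    · refine forall_congr' fun g' => forall_congr' fun a' => ?_
      change b (polar (x j).frame g' a') (polar (x i).frame g a) = 0 ↔ _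
      have hb : b = Matrix.toLinearMap₂' ℂ (LinearMap.toMatrix₂' ℂ b) :=
        (Matrix.toLinearMap₂'_toMatrix' b).symm
      conv_lhs => rw [hb]
      rw [Matrix.toLinearMap₂'_apply']
      simp only [map_mul, map_sum, eval_imgPoly, eval_altPoly]
      rfl

/-- Since dual members have complementary dimensions, one inclusion forces equality; inclusions are
visibly closed conditions. -/
theorem iotaFixed_eq (b : LinearMap.BilinForm ℂ (Fin N → ℂ)) (hb : b.Nondegenerate)
    (hd : ∀ i, d i + d (Fin.rev i) = N) :
    (iotaFixed b : Set (GrProd N d)) =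
      ⋂ i, {x : GrProd N d | (x i).space ≤ b.orthogonal (x (Fin.rev i)).space} := by
  ext x
  simp only [iotaFixed, Set.mem_ofPred_eq, Set.mem_iInter]
  refine forall_congr' fun i => ⟨fun h => h.ge, fun h => ?_⟩
  symm
  apply Submodule.eq_of_le_of_finrank_eq h
  rw [LinearMap.BilinForm.finrank_orthogonal hb, Module.finrank_fin_fun]
  have h1 : finrank ℂ (x i).space = d i := (x i).2
  have h2 : finrank ℂ (x (Fin.rev i)).space = d (Fin.rev i) := (x (Fin.rev i)).2
  have := hd i
  omega

theorem isZariskiClosed_iotaFixed (b : LinearMap.BilinForm ℂ (Fin N → ℂ)) (hb : b.Nondegenerate)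
    (hd : ∀ i, d i + d (Fin.rev i) = N) :
    IsZariskiClosed (iotaFixed b : Set (GrProd N d)) := by
  rw [iotaFixed_eq b hb hd]
  exact IsZariskiClosed.iInter fun i => isZariskiClosed_le_orthogonal b _ _

theorem isZariskiClosed_degFlag (n : ℕ) : IsZariskiClosed (degFlag n) := by
  have : degFlag n = ⋂ (i : Fin n) (j : Fin n) (_ : (j : ℕ) = i + 1),
      {x : AmbV n | (x i).space.map (pr (Fin.castSucc i)) ≤ (x j).space} := by
    ext x
    simp [degFlag]
  rw [this]
  exact IsZariskiClosed.iInter fun i => IsZariskiClosed.iInter fun j =>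
    IsZariskiClosed.iInter fun _ => isZariskiClosed_map_le _ _ _

theorem isZariskiClosed_flagVariety (n : ℕ) : IsZariskiClosed (flagVariety n) := by
  have : flagVariety n = ⋂ (i : Fin n) (j : Fin n) (_ : i ≤ j),
      {x : AmbW n | (x i).space.map LinearMap.id ≤ (x j).space} := by
    ext x
    simp [flagVariety]
  rw [this]
  exact IsZariskiClosed.iInter fun i => IsZariskiClosed.iInter fun j =>
    IsZariskiClosed.iInter fun _ => isZariskiClosed_map_le _ _ _

end


/-! ### Coordinate subspaces and coordinate flags -/

theorem Gr.finrank_space {k N : ℕ} (U : Gr k N) : finrank ℂ U.space = k := U.2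

theorem Gr.eq_of_le {k N : ℕ} {U U' : Gr k N} (h : U.space ≤ U'.space) : U = U' :=
  Gr.ext (Submodule.eq_of_le_of_finrank_eq h (U.finrank_space.trans U'.finrank_space.symm))

/-- The subspace of vectors supported on `s`. -/
def coordSub {N : ℕ} (s : Set (Fin N)) : Submodule ℂ (Fin N → ℂ) where
  carrier := {v | ∀ q, q ∉ s → v q = 0}
  add_mem' := by
    intro v w hv hw q hq
    rw [Pi.add_apply, hv q hq, hw q hq, add_zero]
  zero_mem' := by
    intro q _
    rfl
  smul_mem' := by
    intro c v hv q hq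
    rw [Pi.smul_apply, hv q hq, smul_zero]

theorem single_mem_coordSub {N : ℕ} {s : Set (Fin N)} {q : Fin N} :
    (Pi.single q 1 : Fin N → ℂ) ∈ coordSub s ↔ q ∈ s := by
  constructor
  · intro h
    by_contra hq
    simpa using h q hq
  · intro h r hr
    refine Pi.single_eq_of_ne (fun hrq => hr ?_) 1
    rw [hrq]
    exact h

theorem coordSub_le_iff {N : ℕ} {s : Set (Fin N)} {P : Submodule ℂ (Fin N → ℂ)} :
    coordSub s ≤ P ↔ ∀ q ∈ s, (Pi.single q 1 : Fin N → ℂ) ∈ P := by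
  constructor
  · intro h q hq
    exact h (single_mem_coordSub.2 hq)
  · intro h v hv
    rw [← Finset.univ_sum_single v]
    refine Submodule.sum_mem _ fun q _ => ?_
    by_cases hq : q ∈ s
    · have : (Pi.single q (v q) : Fin N → ℂ) = v q • Pi.single q 1 := by
        ext
        simp [Pi.single_apply]
      rw [this]
      exact Submodule.smul_mem _ _ (h q hq)
    · rw [hv q hq, Pi.single_zero]
      exact P.zero_mem

theorem coordSub_eq_span {N : ℕ} (s : Set (Fin N)) :
    coordSub s =
      Submodule.span ℂ (Set.range fun q : s => (Pi.single (q : Fin N) 1 : Fin N → ℂ)) := by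
  apply le_antisymm
  · rw [coordSub_le_iff]
    intro q hq
    exact Submodule.subset_span ⟨⟨q, hq⟩, rfl⟩
  · rw [Submodule.span_le]
    rintro _ ⟨q, rfl⟩
    exact single_mem_coordSub.2 q.2

theorem finrank_coordSub {N : ℕ} (s : Finset (Fin N)) :
    finrank ℂ (coordSub (s : Set (Fin N))) = s.card := by
  rw [coordSub_eq_span, finrank_span_eq_card]
  · simp
  · have h0 := (Pi.basisFun ℂ (Fin N)).linearIndependent.comp
      (fun q : (s : Set (Fin N)) => (q : Fin N)) Subtype.val_injective
    convert h0 using 1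
    funext r
    simp

/-- The least (zero-based) `i` such that the `i`-th member of the coordinate flag of `τ` contains
`e_q`. -/
def height {n : ℕ} (τ : Equiv.Perm (Fin (2 * n))) (q : Fin (2 * n)) : ℕ :=
  ((τ.symm q : ℕ) + 1) / 2

theorem coordFlag_space {n : ℕ} (τ : Equiv.Perm (Fin (2 * n))) (i : Fin n) :
    (coordFlag τ i).space = coordSub {q | height τ q ≤ i} := by
  change Submodule.span ℂ _ = _
  rw [coordSub_eq_span]
  congr 1
  ext v
  constructor
  · rintro ⟨r, rfl⟩
    refine ⟨⟨τ ⟨r, by omega⟩, ?_⟩, rfl⟩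
    change ((τ.symm (τ _) : ℕ) + 1) / 2 ≤ i
    rw [Equiv.symm_apply_apply]
    simp only
    omega
  · rintro ⟨⟨q, hq⟩, rfl⟩
    have hq' : ((τ.symm q : ℕ) + 1) / 2 ≤ i := hq
    exact ⟨⟨τ.symm q, by omega⟩, by simp⟩

theorem single_mem_coordFlag {n : ℕ} {τ : Equiv.Perm (Fin (2 * n))} {i : Fin n}
    {q : Fin (2 * n)} :
    (Pi.single q 1 : Fin (2 * n) → ℂ) ∈ (coordFlag τ i).space ↔ height τ q ≤ i := by
  rw [coordFlag_space, single_mem_coordSub]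
  rfl

/-- A permutation commuting with the reversal of the indices. -/
def IsSelfDual {n : ℕ} (τ : Equiv.Perm (Fin (2 * n))) : Prop := ∀ r, τ r.rev = (τ r).rev

/-- If `e_q` has position `r`, its dual vector has position `2n-1-r`, and `(r+1)/2 + (2n-r)/2 = n`
for either parity of `r`. A bound on heights at one index thus gives the dual bound at the reversed
index. -/
theorem IsSelfDual.height_rev {n : ℕ} {τ : Equiv.Perm (Fin (2 * n))} (h : IsSelfDual τ)
    (q : Fin (2 * n)) : height τ q.rev + height τ q = n := by
  have h1 : τ.symm q.rev = (τ.symm q).rev := by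
    rw [Equiv.symm_apply_eq, h, Equiv.apply_symm_apply]
  simp only [height, h1, Fin.val_rev]
  omega

/-! ### The symplectic form -/

/-- The signs in the symplectic form. -/
def sgn {n : ℕ} (k : Fin (2 * n)) : ℂ := if (k : ℕ) < n then 1 else -1

theorem sgn_mul_self {n : ℕ} (k : Fin (2 * n)) : sgn k * sgn k = 1 := by
  unfold sgn
  split_ifs <;> norm_num

theorem sgn_ne_zero {n : ℕ} (k : Fin (2 * n)) : sgn k ≠ 0 := by
  unfold sgn
  split_ifs <;> norm_num

theorem sgn_rev {n : ℕ} (k : Fin (2 * n)) : sgn k.rev = -sgn k := by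
  unfold sgn
  rw [Fin.val_rev]
  split_ifs <;> first | omega | norm_num

theorem formW_apply {n : ℕ} (v w : Fin (2 * n) → ℂ) :
    formW n v w = ∑ k, sgn k * v k * w k.rev := by
  rw [formW, Matrix.toBilin'_apply']
  simp only [dotProduct, Matrix.mulVec]
  refine Finset.sum_congr rfl fun k _ => ?_
  rw [Finset.sum_eq_single k.rev]
  · simp [matE, sgn]
  · intro l _ hl
    have : k ≠ l.rev := fun h => hl (by rw [h, Fin.rev_rev])
    simp [matE, this]
  · simp

theorem formW_single_left {n : ℕ} (k : Fin (2 * n)) (w : Fin (2 * n) → ℂ) :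
    formW n (Pi.single k 1) w = sgn k * w k.rev := by
  rw [formW_apply, Finset.sum_eq_single k]
  · simp
  · intro l _ hl
    simp [hl]
  · simp

theorem formW_swap {n : ℕ} (v w : Fin (2 * n) → ℂ) : formW n v w = -formW n w v := by
  rw [formW_apply, formW_apply, ← Finset.sum_neg_distrib, ← Equiv.sum_comp Fin.revPerm]
  refine Finset.sum_congr rfl fun k _ => ?_
  simp only [Fin.revPerm_apply, Fin.rev_rev, sgn_rev]
  ring

theorem formW_single_right {n : ℕ} (k : Fin (2 * n)) (v : Fin (2 * n) → ℂ) :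
    formW n v (Pi.single k 1) = -sgn k * v k.rev := by
  rw [formW_swap, formW_single_left, neg_mul]

theorem formW_self {n : ℕ} (v : Fin (2 * n) → ℂ) : formW n v v = 0 := by
  have := formW_swap v v
  exact self_eq_neg.1 this

theorem formW_eq_zero_of_forall {n : ℕ} {v : Fin (2 * n) → ℂ} (h : ∀ w, formW n w v = 0) :
    v = 0 := by
  funext k
  have := h (Pi.single k.rev 1)
  rw [formW_single_left, Fin.rev_rev] at this
  exact (mul_eq_zero.1 this).resolve_left (sgn_ne_zero _)

theorem formW_nondegenerate (n : ℕ) : (formW n).Nondegenerate := by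
  refine ⟨fun v h => formW_eq_zero_of_forall fun w => ?_, fun v h => formW_eq_zero_of_forall h⟩
  rw [formW_swap, h, neg_zero]

theorem dim_add_dim_rev {n : ℕ} (i : Fin n) :
    (2 * (i : ℕ) + 1) + (2 * ((Fin.rev i : Fin n) : ℕ) + 1) = 2 * n := by
  rw [Fin.val_rev]
  omega

theorem iotaFixed_formW_eq (n : ℕ) : (iotaFixed (formW n) : Set (AmbW n)) =
    ⋂ i, {x : AmbW n | (x i).space ≤ (formW n).orthogonal (x (Fin.rev i)).space} :=
  iotaFixed_eq _ (formW_nondegenerate n) dim_add_dim_rev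

theorem IsSelfDual.coordFlag_mem {n : ℕ} {τ : Equiv.Perm (Fin (2 * n))} (h : IsSelfDual τ) :
    coordFlag τ ∈ iotaFixed (formW n) := by
  rw [iotaFixed_formW_eq, Set.mem_iInter]
  intro i
  rw [Set.mem_ofPred_eq, coordFlag_space, coordFlag_space, coordSub_le_iff]
  intro q hq w hw
  change formW n w _ = 0
  rw [formW_single_right, hw, mul_zero]
  have h1 := h.height_rev q
  have h2 : height τ q ≤ i := hq
  have h3 : ((Fin.rev i : Fin n) : ℕ) = n - (i + 1) := Fin.val_rev i
  change ¬ height τ q.rev ≤ ((Fin.rev i : Fin n) : ℕ)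
  omega

/-! ### Group elements -/

theorem smul_space {n : ℕ} (g : SL n) (x : AmbW n) (i : Fin n) :
    ((g • x) i).space = (x i).space.map (Matrix.SpecialLinearGroup.toLin' g).toLinearMap := rfl

theorem mulVec_mem_smul {n : ℕ} {g : SL n} {x : AmbW n} {i : Fin n} {w : Fin (2 * n) → ℂ}
    (hw : w ∈ (x i).space) : g.1.mulVec w ∈ ((g • x) i).space := ⟨w, hw, rfl⟩

theorem mem_smul_iff {n : ℕ} {g : SL n} {x : AmbW n} {i : Fin n} {w : Fin (2 * n) → ℂ} :
    w ∈ ((g • x) i).space ↔ (g⁻¹).1.mulVec w ∈ (x i).space := by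
  constructor
  · intro h
    have := mulVec_mem_smul (g := g⁻¹) h
    rwa [inv_smul_smul] at this
  · intro h
    have := mulVec_mem_smul (g := g) h
    rw [Matrix.mulVec_mulVec] at this
    have h2 : g.1 * (g⁻¹).1 = 1 := congrArg Subtype.val (mul_inv_cancel g)
    rwa [h2, Matrix.one_mulVec] at this

theorem mem_Sp_iff {n : ℕ} {g : SL n} :
    g ∈ Sp n ↔ ∀ v w, formW n (g.1.mulVec v) (g.1.mulVec w) = formW n v w := Iff.rfl

theorem smul_mem_iotaFixed {n : ℕ} {g : SL n} (hg : g ∈ Sp n) {x : AmbW n}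
    (hx : x ∈ iotaFixed (formW n)) : g • x ∈ iotaFixed (formW n) := by
  rw [iotaFixed_formW_eq, Set.mem_iInter] at hx ⊢
  rintro i _ ⟨w, hw, rfl⟩ _ ⟨w', hw', rfl⟩
  change formW n (g.1.mulVec w') (g.1.mulVec w) = 0
  rw [mem_Sp_iff.1 hg]
  exact hx i hw w' hw'

theorem borel_inv_mem {n : ℕ} {g : SL n} (hg : g ∈ borel n) : g⁻¹ ∈ borel n := by
  have h1 : g.1.BlockTriangular id := fun k l h => hg k l h
  have hd : IsUnit g.1 := by
    rw [Matrix.isUnit_iff_isUnit_det, g.2]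
    exact isUnit_one
  have := hd.invertible
  have h2 := Matrix.blockTriangular_inv_of_blockTriangular h1
  intro k l h
  have h3 : (g⁻¹).1 = g.1⁻¹ := by
    rw [Matrix.inv_def, g.2]
    simp [Matrix.SpecialLinearGroup.coe_inv]
  rw [h3]
  exact h2 h

/-- The Borel subgroup `B^ι` of `Sp_{2n}`. -/
def spBorel (n : ℕ) : Subgroup (SL n) where
  carrier := borel n ∩ (Sp n : Set (SL n))
  mul_mem' := by
    rintro a b ⟨ha, ha'⟩ ⟨hb, hb'⟩
    refine ⟨?_, (Sp n).mul_mem ha' hb'⟩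
    have h1 : a.1.BlockTriangular id := fun k l h => ha k l h
    have h2 : b.1.BlockTriangular id := fun k l h => hb k l h
    exact fun k l h => (h1.mul h2) h
  one_mem' := ⟨fun k l h => Matrix.one_apply_ne h.ne', (Sp n).one_mem⟩
  inv_mem' := by
    rintro a ⟨ha, ha'⟩
    exact ⟨borel_inv_mem ha, (Sp n).inv_mem ha'⟩

/-! ### Eichler transformations of the symplectic space -/

/-- The map `v ↦ v + ω(v,e) u + ω(v,u) e`. -/
def eichler {n : ℕ} (e u : Fin (2 * n) → ℂ) : (Fin (2 * n) → ℂ) →ₗ[ℂ] (Fin (2 * n) → ℂ) :=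
  LinearMap.id + ((formW n).flip e).smulRight u + ((formW n).flip u).smulRight e

theorem eichler_apply {n : ℕ} (e u v : Fin (2 * n) → ℂ) :
    eichler e u v = v + formW n v e • u + formW n v u • e := rfl

theorem formW_eichler {n : ℕ} {e u : Fin (2 * n) → ℂ} (h : formW n e u = 0)
    (v w : Fin (2 * n) → ℂ) : formW n (eichler e u v) (eichler e u w) = formW n v w := by
  have h' : formW n u e = 0 := by rw [formW_swap, h, neg_zero]
  simp only [eichler_apply, map_add, map_smul, LinearMap.add_apply, LinearMap.smul_apply,
    smul_eq_mul, formW_self, h, h', formW_swap u w, formW_swap e w]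
  ring

/-- With these orthogonality relations the values `ω(v,e)` and `ω(v,u)` do not change under the
first map, so the increments add. This yields inverses and square roots. -/
theorem eichler_comp {n : ℕ} {e u u' : Fin (2 * n) → ℂ} (h : formW n e u = 0)
    (h' : formW n e u' = 0) (h'' : formW n u u' = 0) :
    eichler e u ∘ₗ eichler e u' = eichler e (u + u') := by
  have h3 : formW n u' e = 0 := by rw [formW_swap, h', neg_zero]
  have h4 : formW n u' u = 0 := by rw [formW_swap, h'', neg_zero]
  refine LinearMap.ext fun v => ?_
  simp only [LinearMap.comp_apply, eichler_apply, map_add, map_smul, formW_self, h, h3, h4]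
  module

/-- Preserving a nondegenerate form only gives determinant with square one. The map is the square of
the one with `u/2`, which removes the sign. -/
theorem det_eichler {n : ℕ} {e u : Fin (2 * n) → ℂ} (h : formW n e u = 0) :
    (LinearMap.toMatrix' (eichler e u)).det = 1 := by
  have hhalf : formW n e ((1 / 2 : ℂ) • u) = 0 := by rw [map_smul, h, smul_zero]
  have h1 := eichler_comp hhalf hhalf (formW_self _)
  rw [← add_smul, show (1 / 2 + 1 / 2 : ℂ) = 1 by norm_num, one_smul] at h1
  rw [← h1, LinearMap.toMatrix'_comp, Matrix.det_mul]
  set A := LinearMap.toMatrix' (eichler e ((1 / 2 : ℂ) • u)) with hA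
  have h2 : A.transpose * matE n * A = matE n := by
    apply (Matrix.toBilin' (R₁ := ℂ)).injective
    refine LinearMap.ext fun v => LinearMap.ext fun w => ?_
    have h3 := formW_eichler hhalf v w
    rw [formW, ← LinearMap.toMatrix'_mulVec, ← LinearMap.toMatrix'_mulVec (eichler _ _) w, ← hA]
      at h3
    rw [Matrix.toBilin'_apply', Matrix.toBilin'_apply'] at h3 ⊢
    rw [← h3, ← Matrix.mulVec_mulVec, ← Matrix.mulVec_mulVec, Matrix.dotProduct_mulVec,
      Matrix.vecMul_transpose]
  have h4 := congrArg Matrix.det h2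
  have h5 : (matE n).det ≠ 0 := by
    have := (formW_nondegenerate n)
    rwa [formW, LinearMap.BilinForm.nondegenerate_toBilin'_iff_det_ne_zero] at this
  rw [Matrix.det_mul, Matrix.det_mul, Matrix.det_transpose] at h4
  apply mul_right_cancel₀ h5
  linear_combination h4

/-- `eichler e u` as an element of `SL_{2n}`. -/
def eichlerSL {n : ℕ} (e u : Fin (2 * n) → ℂ) (h : formW n e u = 0) : SL n :=
  ⟨LinearMap.toMatrix' (eichler e u), det_eichler h⟩

theorem eichlerSL_mulVec {n : ℕ} {e u : Fin (2 * n) → ℂ} (h : formW n e u = 0)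
    (v : Fin (2 * n) → ℂ) :
    (eichlerSL e u h).1.mulVec v = v + formW n v e • u + formW n v u • e :=
  LinearMap.toMatrix'_mulVec _ _

theorem eichlerSL_mem_Sp {n : ℕ} {e u : Fin (2 * n) → ℂ} (h : formW n e u = 0) :
    eichlerSL e u h ∈ Sp n := by
  rw [mem_Sp_iff]
  intro v w
  have := formW_eichler h v w
  rwa [← LinearMap.toMatrix'_mulVec, ← LinearMap.toMatrix'_mulVec (eichler _ _) w] at this

theorem eichlerSL_mul {n : ℕ} {e u u' : Fin (2 * n) → ℂ} (h : formW n e u = 0)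
    (h' : formW n e u' = 0) (h'' : formW n u u' = 0) :
    eichlerSL e u h * eichlerSL e u' h' =
      eichlerSL e (u + u') (by rw [map_add, h, h', add_zero]) := by
  apply Subtype.ext
  change LinearMap.toMatrix' _ * LinearMap.toMatrix' _ = LinearMap.toMatrix' _
  rw [← LinearMap.toMatrix'_comp, eichler_comp h h' h'']

theorem eichlerSL_zero {n : ℕ} (e : Fin (2 * n) → ℂ) (h : formW n e 0 = 0) :
    eichlerSL e 0 h = 1 := by
  apply Subtype.ext
  change LinearMap.toMatrix' _ = 1
  rw [← LinearMap.toMatrix'_id]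
  congr 1
  refine LinearMap.ext fun v => ?_
  simp [eichler_apply]


/-! ### The Bruhat decomposition for isotropic flags -/

theorem smul_mem_flagVariety {n : ℕ} {g : SL n} {x : AmbW n} (hx : x ∈ flagVariety n) :
    g • x ∈ flagVariety n :=
  fun i j hij => Submodule.map_mono (hx i j hij)

/-- A vector with last nonzero coordinate `w k = 1` is the image of `e_k` under an element of `B^ι`
which fixes the basis vectors orthogonal to `w` away from `k`. -/
theorem exists_spBorel_mulVec_eq {n : ℕ} (w : Fin (2 * n) → ℂ) (k : Fin (2 * n)) (hk : w k = 1)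
    (hw : ∀ p, k < p → w p = 0) :
    ∃ T ∈ spBorel n, T.1.mulVec (Pi.single k 1) = w ∧
      ∀ q, q ≠ k → w q.rev = 0 → T.1.mulVec (Pi.single q 1) = Pi.single q 1 := by
  have hkr : k ≠ k.rev := by
    intro h
    have := congrArg Fin.val h
    rw [Fin.val_rev] at this
    omega
  set e : Fin (2 * n) → ℂ := Pi.single k.rev 1 with he
  -- The map sends `e_k` to `e_k + sgn k • u + (sgn k * u k.rev) • e`. The last term adds to the
  -- `e`-component already present in `u`, so `u` carries only half of `w k.rev`.
  set u : Fin (2 * n) → ℂ := sgn k • (w - Pi.single k 1 - (1 / 2 * w k.rev) • e) with hu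
  have hek : e k = 0 := Pi.single_eq_of_ne hkr 1
  have her : e k.rev = 1 := Pi.single_eq_same _ _
  have huk : u k = 0 := by
    simp [hu, hk, hek]
  have hur : u k.rev = sgn k * (1 / 2 * w k.rev) := by
    simp only [hu, Pi.smul_apply, Pi.sub_apply, her, Pi.single_eq_of_ne hkr.symm, smul_eq_mul]
    ring
  have hup : ∀ p, k < p → u p = 0 := by
    intro p hp
    have h1 : w k.rev * e p = 0 := by
      by_cases hpr : p = k.rev
      · rw [← hpr, hw p hp, zero_mul]
      · rw [he, Pi.single_eq_of_ne hpr, mul_zero]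
    simp only [hu, Pi.smul_apply, Pi.sub_apply, hw p hp, Pi.single_eq_of_ne hp.ne', smul_eq_mul]
    linear_combination (-(sgn k) * 1 / 2) * h1
  have heu : formW n e u = 0 := by
    rw [he, formW_single_left, Fin.rev_rev, huk, mul_zero]
  have hsingle : ∀ q, (eichlerSL e u heu).1.mulVec (Pi.single q 1) =
      Pi.single q 1 + (sgn q * e q.rev) • u + (sgn q * u q.rev) • e := by
    intro q
    rw [eichlerSL_mulVec, formW_single_left, formW_single_left]
  have hne : ∀ q, q ≠ k → e q.rev = 0 := fun q hq =>
    Pi.single_eq_of_ne (fun h => hq (Fin.rev_injective h)) 1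
  refine ⟨eichlerSL e u heu, ⟨?_, eichlerSL_mem_Sp heu⟩, ?_, ?_⟩
  -- The `u`-term occurs only for `l = k`, where `u` has no coordinates beyond `k`. The `e`-term
  -- needs `l.rev ≤ k`, that is `k.rev ≤ l`. Neither contributes below the diagonal.
  · intro p l hlp
    have h := congrFun (hsingle l) p
    rw [Matrix.mulVec_single_one] at h
    refine Eq.trans h ?_
    have h1 : (sgn l * e l.rev) * u p = 0 := by
      by_cases hl : l = k
      · rw [hup p (hl ▸ hlp), mul_zero]
      · rw [hne l hl, mul_zero, zero_mul]
    have h2 : (sgn l * u l.rev) * e p = 0 := by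
      by_cases hp : p = k.rev
      · rw [hup l.rev, mul_zero, zero_mul]
        rw [hp] at hlp
        rw [← Fin.rev_rev k]
        exact Fin.rev_lt_rev.2 hlp
      · rw [he, Pi.single_eq_of_ne hp, mul_zero]
    simp only [Pi.add_apply, Pi.smul_apply, smul_eq_mul, h1, h2, Pi.single_eq_of_ne hlp.ne',
      add_zero]
  · rw [hsingle, her, hur, mul_one, ← mul_assoc, sgn_mul_self, one_mul, hu, smul_smul,
      sgn_mul_self]
    module
  · intro q hq hwq
    have h2 : u q.rev = 0 := by
      have hqk : q.rev ≠ k := fun h => by rw [h, hk] at hwq; exact one_ne_zero hwq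
      simp [hu, hwq, hne q hq, hqk]
    rw [hsingle, hne q hq, h2]
    simp

/-- Gaussian elimination along the flag, one vector at a time. The member with zero-based index `i`
has dimension `2i+1`, so it should receive the positions `0, …, 2i`. A new vector `w` is normalised
at its last nonzero coordinate `k`; isotropy makes the transformation with `e_k ↦ w` fix the basis
vectors already found, and its inverse straightens `w` to `e_k`. -/
theorem exists_adapted_indices {m n : ℕ} (hm : 1 ≤ m) (hn : n = 2 * m - 1) {x : AmbW n}
    (hx : x ∈ flagVariety n) (hx' : x ∈ iotaFixed (formW n)) (r : ℕ) (hr : r ≤ n) :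
    ∃ g ∈ spBorel n, ∃ t : ℕ → Fin (2 * n), (∀ a < r, ∀ b < r, t a = t b → a = b) ∧
      (∀ a < r, ∀ b < r, t a ≠ (t b).rev) ∧
      ∀ a < r, ∀ i : Fin n, a ≤ 2 * (i : ℕ) →
        (Pi.single (t a) 1 : Fin (2 * n) → ℂ) ∈ ((g • x) i).space := by
  induction r with
  | zero =>
    exact ⟨1, (spBorel n).one_mem, fun _ => ⟨0, by omega⟩, by simp, by simp, by simp⟩
  | succ r ih =>
    obtain ⟨g, hg, t, ht, ht', hmem⟩ := ih (by omega)
    let y := g • x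
    have hy : y ∈ flagVariety n := smul_mem_flagVariety hx
    have hy' : y ∈ iotaFixed (formW n) := smul_mem_iotaFixed hg.2 hx'
    -- The first member of dimension at least `r + 1`.
    let i₀ : Fin n := ⟨(r + 1) / 2, by omega⟩
    let S : Finset (Fin (2 * n)) := (Finset.range r).image t
    have hS : coordSub (S : Set (Fin (2 * n))) ≤ (y i₀).space := by
      rw [coordSub_le_iff]
      intro q hq
      obtain ⟨a, ha, rfl⟩ := Finset.mem_image.1 (Finset.mem_coe.1 hq)
      have ha := Finset.mem_range.1 ha
      exact hmem a ha i₀ (by change a ≤ 2 * ((r + 1) / 2); omega)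
    obtain ⟨w₀, hw₀, hw₀'⟩ : ∃ w ∈ (y i₀).space, w ∉ coordSub (S : Set (Fin (2 * n))) := by
      by_contra! hcon
      have h1 := Submodule.finrank_mono (show (y i₀).space ≤ coordSub (S : Set _) from hcon)
      rw [finrank_coordSub, Gr.finrank_space] at h1
      have h2 : S.card ≤ r := Finset.card_image_le.trans_eq (Finset.card_range r)
      change 2 * ((r + 1) / 2) + 1 ≤ S.card at h1
      omega
    -- The coordinates already used may be cleared, because their basis vectors lie in the same
    -- member.
    let w₁ : Fin (2 * n) → ℂ := fun q => if q ∈ S then 0 else w₀ q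
    have hw₁ : w₁ ∈ (y i₀).space := by
      have : w₀ - w₁ ∈ coordSub (S : Set (Fin (2 * n))) := by
        intro q hq
        have hq' : q ∉ S := hq
        simp [w₁, hq']
      have h2 := Submodule.sub_mem _ hw₀ (hS this)
      rwa [sub_sub_cancel] at h2
    have hne : (Finset.univ.filter fun q => w₁ q ≠ 0).Nonempty := by
      by_contra hcon
      rw [Finset.not_nonempty_iff_eq_empty, Finset.filter_eq_empty_iff] at hcon
      apply hw₀'
      intro q hq
      have hq' : q ∉ S := hq
      have := hcon (Finset.mem_univ q)
      simpa [w₁, hq'] using this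
    let k := (Finset.univ.filter fun q => w₁ q ≠ 0).max' hne
    have hk : w₁ k ≠ 0 := (Finset.mem_filter.1 (Finset.max'_mem _ hne)).2
    have hkmax : ∀ p, k < p → w₁ p = 0 := by
      intro p hp
      by_contra h
      exact absurd (Finset.le_max' _ p (Finset.mem_filter.2 ⟨Finset.mem_univ _, h⟩))
        (not_le_of_gt hp)
    let w : Fin (2 * n) → ℂ := (w₁ k)⁻¹ • w₁
    have hw : w ∈ (y i₀).space := Submodule.smul_mem _ _ hw₁
    have hwk : w k = 1 := inv_mul_cancel₀ hk
    have hwt : ∀ a < r, w (t a) = 0 := by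
      intro a ha
      have : t a ∈ S := Finset.mem_image_of_mem _ (Finset.mem_range.2 ha)
      simp [w, w₁, this]
    -- As `r < n`, the earlier vectors also lie in the dual member, to which `w` is orthogonal.
    have hwt' : ∀ a < r, w (t a).rev = 0 := by
      intro a ha
      have h1 : w ∈ (formW n).orthogonal (y i₀.rev).space := by
        rw [hy' i₀]
        exact hw
      have h2 : (Pi.single (t a) 1 : Fin (2 * n) → ℂ) ∈ (y i₀.rev).space := by
        apply hmem a ha
        rw [Fin.val_rev]
        change a ≤ 2 * (n - ((r + 1) / 2 + 1))
        omega
      have h3 : formW n (Pi.single (t a) 1) w = 0 := h1 _ h2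
      rw [formW_single_left] at h3
      exact (mul_eq_zero.1 h3).resolve_left (sgn_ne_zero _)
    obtain ⟨T, hT, hTk, hTq⟩ := exists_spBorel_mulVec_eq w k hwk
      (fun p hp => by simp [w, hkmax p hp])
    have hkt : ∀ a < r, t a ≠ k := fun a ha h => by
      have := hwt a ha
      rw [h, hwk] at this
      exact one_ne_zero this
    have hkt' : ∀ a < r, (t a).rev ≠ k := fun a ha h => by
      have := hwt' a ha
      rw [h, hwk] at this
      exact one_ne_zero this
    have hkk : k ≠ k.rev := by
      intro h
      have := congrArg Fin.val h
      rw [Fin.val_rev] at this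
      omega
    refine ⟨T⁻¹ * g, (spBorel n).mul_mem ((spBorel n).inv_mem hT) hg,
      fun a => if a = r then k else t a, ?_, ?_, ?_⟩
    · intro a ha b hb
      by_cases h1 : a = r <;> by_cases h2 : b = r
      · simp [h1, h2]
      · simp only [h1, h2, if_true, if_false]
        exact fun h => absurd h.symm (hkt b (by omega))
      · simp only [h1, h2, if_true, if_false]
        exact fun h => absurd h (hkt a (by omega))
      · simp only [h1, h2, if_false]
        exact ht a (by omega) b (by omega)
    · intro a ha b hb
      by_cases h1 : a = r <;> by_cases h2 : b = r
      · simpa [h1, h2] using hkk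
      · simp only [h1, h2, if_true, if_false]
        exact (hkt' b (by omega)).symm
      · simp only [h1, h2, if_true, if_false]
        intro h
        exact hkt' a (by omega) (by rw [h, Fin.rev_rev])
      · simp only [h1, h2, if_false]
        exact ht' a (by omega) b (by omega)
    · intro a ha i hai
      rw [mul_smul, mem_smul_iff, inv_inv]
      by_cases h1 : a = r
      · simp only [h1, if_true, hTk]
        refine hy i₀ i ?_ hw
        change (r + 1) / 2 ≤ (i : ℕ)
        omega
      · simp only [h1, if_false]
        rw [hTq _ (hkt a (by omega)) (hwt' a (by omega))]
        exact hmem a (by omega) i hai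

/-- Every `ι`-fixed flag is `B^ι`-conjugate to a coordinate flag. -/
theorem exists_spBorel_smul_eq_coordFlag {m n : ℕ} (hm : 1 ≤ m) (hn : n = 2 * m - 1) {x : AmbW n}
    (hx : x ∈ flagVariety n) (hx' : x ∈ iotaFixed (formW n)) :
    ∃ g ∈ spBorel n, ∃ τ : Equiv.Perm (Fin (2 * n)), IsSelfDual τ ∧ g • x = coordFlag τ := by
  obtain ⟨g, hg, t, ht, ht', hmem⟩ := exists_adapted_indices hm hn hx hx' n le_rfl
  -- The first `n` positions determine the rest by self-duality.
  let f : Fin (2 * n) → Fin (2 * n) := fun r =>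
    if (r : ℕ) < n then t r else (t (r.rev : Fin (2 * n))).rev
  have hf : Function.Injective f := by
    intro a b hab
    have ha := a.2
    have hb := b.2
    simp only [f] at hab
    apply Fin.ext
    split_ifs at hab with h1 h2 h2
    · exact ht _ h1 _ h2 hab
    · exact absurd hab (ht' _ h1 _ (by rw [Fin.val_rev]; omega))
    · exact absurd hab.symm (ht' _ h2 _ (by rw [Fin.val_rev]; omega))
    · have := ht _ (by rw [Fin.val_rev]; omega) _ (by rw [Fin.val_rev]; omega)
        (Fin.rev_injective hab)
      rw [Fin.val_rev, Fin.val_rev] at this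
      omega
  let τ : Equiv.Perm (Fin (2 * n)) := Equiv.ofBijective f (Finite.injective_iff_bijective.1 hf)
  have hτ : IsSelfDual τ := by
    intro r
    have hr := r.2
    change f r.rev = (f r).rev
    simp only [f]
    rw [Fin.val_rev]
    split_ifs with h1 h2 h2
    · omega
    · rw [Fin.rev_rev]
    · rw [Fin.rev_rev]
    · omega
  refine ⟨g, hg, τ, hτ, ?_⟩
  have hy' : g • x ∈ iotaFixed (formW n) := smul_mem_iotaFixed hg.2 hx'
  have hlow : ∀ i : Fin n, 2 * (i : ℕ) < n → coordFlag τ i = (g • x) i := by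
    intro i hi
    apply Gr.eq_of_le
    change Submodule.span ℂ _ ≤ _
    rw [Submodule.span_le]
    rintro _ ⟨r, rfl⟩
    have hr : (r : ℕ) < n := by omega
    have h1 : τ ⟨r, by omega⟩ = t r := if_pos hr
    change (Pi.single (τ ⟨r, _⟩) 1 : Fin (2 * n) → ℂ) ∈ _
    rw [h1]
    exact hmem r hr i (by omega)
  -- The remaining members are the orthogonal complements of those already compared.
  funext i
  by_cases hi : 2 * (i : ℕ) < n
  · exact (hlow i hi).symm
  · apply Gr.ext
    rw [← hy' i, ← hτ.coordFlag_mem i, hlow]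
    rw [Fin.val_rev]
    omega


/-! ### Curves and reflections -/

/-- Closed sets contain the limit points of curves `ε ↦ h(ε) x`. -/
theorem mem_of_curve {n : ℕ} {Z : Set (AmbW n)} (hZ : IsZariskiClosed Z) (h : ℂ → SL n)
    (hc : Continuous fun ε => (h ε).1) (x : AmbW n) (hx : ∀ ε ≠ 0, h ε • x ∈ Z) :
    h 0 • x ∈ Z := by
  obtain ⟨S, hS, rfl⟩ := hZ
  intro F hF
  obtain ⟨e, he⟩ := hS F hF
  -- The bases behind `coords` need not vary continuously with `ε`. Transporting a fixed basis of
  -- `x` gives a continuous family, and vanishing of a multihomogeneous polynomial does not depend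
  -- on the bases.
  have hspan : ∀ ε i, Submodule.span ℂ (Set.range fun c => (h ε).1.mulVec ((x i).frame c)) =
      ((h ε • x) i).space := by
    intro ε i
    rw [smul_space, ← (x i).span_frame, Submodule.map_span, ← Set.range_comp]
    rfl
  have key := fun ε => he.eval_eq_zero_iff (h ε • x) _ (hspan ε)
  have hcont : Continuous fun ε =>
      eval (fun q : PluckerIndex (2 * n) (fun i : Fin n => 2 * (i : ℕ) + 1) =>
      minor q.2 (fun c => (h ε).1.mulVec ((x q.1).frame c))) F := by
    refine (MvPolynomial.continuous_eval F).comp (continuous_pi fun q => ?_)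
    simp only [minor_apply]
    refine Continuous.matrix_det (continuous_matrix fun a c => ?_)
    simp only [Matrix.of_apply]
    exact (continuous_apply (q.2 a)).comp
      (hc.matrix_mulVec (continuous_const (y := (x q.1).frame c)))
  have hzero := hcont.ext_on (dense_compl_singleton (0 : ℂ)) continuous_const
    (fun ε hε => (key ε).2 (hx ε hε F hF))
  exact (key 0).1 (congrFun hzero 0)

theorem formW_single_rev_smul {n : ℕ} {k l : Fin (2 * n)} (h : k ≠ l) (ε : ℂ) :
    formW n (Pi.single k.rev 1) (ε • Pi.single l 1) = 0 := by
  rw [formW_single_left, Fin.rev_rev, Pi.smul_apply, Pi.single_eq_of_ne h, smul_zero, mul_zero]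

/-- The root element which maps `e_k` to `e_k` plus a multiple of `e_l`. -/
def rootSL {n : ℕ} {k l : Fin (2 * n)} (h : k ≠ l) (ε : ℂ) : SL n :=
  eichlerSL (Pi.single k.rev 1) (ε • Pi.single l 1) (formW_single_rev_smul h ε)

theorem rootSL_mulVec_single {n : ℕ} {k l : Fin (2 * n)} (h : k ≠ l) (ε : ℂ) (q : Fin (2 * n)) :
    (rootSL h ε).1.mulVec (Pi.single q 1) = Pi.single q 1 +
      (if q = k then sgn q * ε else 0) • Pi.single l 1 +
      (if q.rev = l then sgn q * ε else 0) • Pi.single k.rev 1 := by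
  rw [rootSL, eichlerSL_mulVec, formW_single_left, formW_single_left, smul_smul, Pi.smul_apply,
    smul_eq_mul]
  congr 3
  · by_cases hq : q = k
    · simp [hq]
    · have : q.rev ≠ k.rev := fun h => hq (Fin.rev_injective h)
      simp [hq, this]
  · by_cases hq : q.rev = l
    · simp [hq]
    · simp [hq]

theorem rootSL_mem_Sp {n : ℕ} {k l : Fin (2 * n)} (h : k ≠ l) (ε : ℂ) : rootSL h ε ∈ Sp n :=
  eichlerSL_mem_Sp _

theorem rootSL_mem_spBorel {n : ℕ} {k l : Fin (2 * n)} (h : l < k) (ε : ℂ) :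
    rootSL h.ne' ε ∈ spBorel n := by
  refine ⟨?_, rootSL_mem_Sp _ _⟩
  intro p q hqp
  have h1 := congrFun (rootSL_mulVec_single h.ne' ε q) p
  rw [Matrix.mulVec_single_one] at h1
  refine Eq.trans h1 ?_
  simp only [Pi.add_apply, Pi.smul_apply, smul_eq_mul, Pi.single_eq_of_ne hqp.ne', zero_add]
  have h2 : (if q = k then sgn q * ε else 0) * (Pi.single l 1 : Fin (2 * n) → ℂ) p = 0 := by
    split_ifs with hq
    · rw [Pi.single_eq_of_ne, mul_zero]
      rintro rfl
      exact absurd (h.trans_le hq.ge) (not_lt_of_gt hqp)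
    · rw [zero_mul]
  have h3 : (if q.rev = l then sgn q * ε else 0) *
      (Pi.single k.rev 1 : Fin (2 * n) → ℂ) p = 0 := by
    split_ifs with hq
    · rw [Pi.single_eq_of_ne, mul_zero]
      rintro rfl
      rw [← hq, Fin.rev_lt_iff] at h
      exact absurd h (not_lt_of_gt hqp)
    · rw [zero_mul]
  rw [h2, h3, add_zero]

theorem rootSL_zero {n : ℕ} {k l : Fin (2 * n)} (h : k ≠ l) : rootSL h 0 = 1 := by
  have : ∀ u : Fin (2 * n) → ℂ, u = 0 → ∀ hu, eichlerSL (Pi.single k.rev 1) u hu = 1 := by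
    rintro u rfl hu
    exact eichlerSL_zero _ hu
  exact this _ (zero_smul _ _) _

theorem rootSL_inv {n : ℕ} {k l : Fin (2 * n)} (h : k ≠ l) (ε : ℂ) :
    (rootSL h ε)⁻¹ = rootSL h (-ε) := by
  rw [inv_eq_iff_mul_eq_one, rootSL, rootSL, eichlerSL_mul _ _ (by simp [formW_self])]
  have : ∀ u : Fin (2 * n) → ℂ, u = 0 → ∀ hu, eichlerSL (Pi.single k.rev 1) u hu = 1 := by
    rintro u rfl hu
    exact eichlerSL_zero _ hu
  exact this _ (by module) _

theorem continuous_rootSL {n : ℕ} {k l : Fin (2 * n)} (h : k ≠ l) :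
    Continuous fun ε => (rootSL h ε).1 := by
  refine continuous_matrix fun p q => ?_
  have : (fun ε => (rootSL h ε).1 p q) = fun ε => (Pi.single q 1 +
      (if q = k then sgn q * ε else 0) • Pi.single l 1 +
      (if q.rev = l then sgn q * ε else 0) • Pi.single k.rev 1 : Fin (2 * n) → ℂ) p := by
    funext ε
    rw [← rootSL_mulVec_single h, Matrix.mulVec_single_one]
    rfl
  rw [this]
  split_ifs <;> simp only [Pi.add_apply, Pi.smul_apply, smul_eq_mul] <;> fun_prop

/-- The reflection which exchanges `k` and `l`, and `k^*` and `l^*`. -/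
def rootPerm {n : ℕ} (k l : Fin (2 * n)) : Equiv.Perm (Fin (2 * n)) :=
  -- For `l = k^*` the two transpositions coincide and their product would be trivial.
  if l = k.rev then Equiv.swap k l else Equiv.swap k l * Equiv.swap k.rev l.rev

theorem sgn_eq_one_or {n : ℕ} (k : Fin (2 * n)) : sgn k = 1 ∨ sgn k = -1 := by
  unfold sgn
  split_ifs <;> simp

theorem ne_rev {n : ℕ} (k : Fin (2 * n)) : k ≠ k.rev := by
  intro h
  have := congrArg Fin.val h
  rw [Fin.val_rev] at this
  omega

theorem rootPerm_apply {n : ℕ} {k l : Fin (2 * n)} (h : k ≠ l) (q : Fin (2 * n)) :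
    rootPerm k l q = if q = k then l else if q = l then k else if q = k.rev then l.rev else
      if q = l.rev then k.rev else q := by
  have hk := ne_rev k
  have hl := ne_rev l
  have hkl : k.rev ≠ l.rev := fun hh => h (Fin.rev_injective hh)
  unfold rootPerm
  by_cases hlk : l = k.rev
  · subst hlk
    simp only [if_true, Fin.rev_rev, Equiv.swap_apply_def]
    split_ifs <;> simp_all
  · have hlk' : k ≠ l.rev := fun hh => hlk (by rw [hh, Fin.rev_rev])
    rw [if_neg hlk, Equiv.Perm.mul_apply]
    simp only [Equiv.swap_apply_def]
    split_ifs <;> simp_all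

theorem rootPerm_rootPerm {n : ℕ} {k l : Fin (2 * n)} (h : k ≠ l) (q : Fin (2 * n)) :
    rootPerm k l (rootPerm k l q) = q := by
  have hk := ne_rev k
  have hl := ne_rev l
  have hkl : k.rev ≠ l.rev := fun hh => h (Fin.rev_injective hh)
  have h1 : l = k.rev ↔ k = l.rev := 
    ⟨fun h => by rw [h, Fin.rev_rev], fun h => by rw [h, Fin.rev_rev]⟩
  have h2 : l.rev = k ↔ k.rev = l := Fin.rev_eq_iff.trans eq_comm
  simp only [rootPerm_apply h]
  split_ifs <;> grind

theorem rootPerm_rev {n : ℕ} {k l : Fin (2 * n)} (h : k ≠ l) (q : Fin (2 * n)) :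
    rootPerm k l q.rev = (rootPerm k l q).rev := by
  have hk := ne_rev k
  have hl := ne_rev l
  have h1 : ∀ a b : Fin (2 * n), a.rev = b ↔ a = b.rev := fun a b => Fin.rev_eq_iff
  simp only [rootPerm_apply h, h1, Fin.rev_rev]
  split_ifs <;> simp_all

theorem IsSelfDual.trans_rootPerm {n : ℕ} {τ : Equiv.Perm (Fin (2 * n))} (hτ : IsSelfDual τ)
    {k l : Fin (2 * n)} (h : k ≠ l) : IsSelfDual (τ.trans (rootPerm k l)) := by
  intro r
  rw [Equiv.trans_apply, Equiv.trans_apply, hτ, rootPerm_rev h]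

theorem height_trans_rootPerm {n : ℕ} (τ : Equiv.Perm (Fin (2 * n))) {k l : Fin (2 * n)}
    (h : k ≠ l) (q : Fin (2 * n)) :
    height (τ.trans (rootPerm k l)) q = height τ (rootPerm k l q) := by
  unfold height
  rw [Equiv.symm_trans_apply]
  congr 4
  rw [Equiv.symm_apply_eq, rootPerm_rootPerm h]

/-- The action of opposite root elements on a coordinate flag. -/
theorem exists_rootSL_smul_eq {n : ℕ} {τ : Equiv.Perm (Fin (2 * n))} (hτ : IsSelfDual τ)
    {k l : Fin (2 * n)} (h : k ≠ l) (hkl : height τ k ≤ height τ l) {ε : ℂ} (hε : ε ≠ 0) :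
    ∃ δ : ℂ, rootSL h ε • coordFlag τ =
      rootSL h.symm δ • coordFlag (τ.trans (rootPerm k l)) := by
  have hk := ne_rev k
  have hl := ne_rev l
  have hkl' : k.rev ≠ l.rev := fun hh => h (Fin.rev_injective hh)
  have hhk := hτ.height_rev k
  have hhl := hτ.height_rev l
  -- This is the factorisation in `SL_2` of a unipotent element through the opposite unipotent
  -- subgroup and the Weyl reflection. By equality of dimensions it is enough to test one inclusion
  -- on basis vectors.
  suffices hs : ∃ δ : ℂ, ∀ (i : Fin n) (q : Fin (2 * n)), height τ q ≤ i →
      (rootSL h.symm (-δ)).1.mulVec ((rootSL h ε).1.mulVec (Pi.single q 1)) ∈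
        (coordFlag (τ.trans (rootPerm k l)) i).space by
    obtain ⟨δ, hδ⟩ := hs
    refine ⟨δ, funext fun i => Gr.eq_of_le ?_⟩
    rw [smul_space, Submodule.map_le_iff_le_comap, coordFlag_space, coordSub_le_iff]
    intro q hq
    rw [Submodule.mem_comap, mem_smul_iff, rootSL_inv]
    exact hδ i q hq
  have hP : ∀ (i : Fin n) (q : Fin (2 * n)), height τ (rootPerm k l q) ≤ i →
      (Pi.single q 1 : Fin (2 * n) → ℂ) ∈ (coordFlag (τ.trans (rootPerm k l)) i).space := by
    intro i q hq
    rwa [single_mem_coordFlag, height_trans_rootPerm τ h]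
  by_cases hlk : l = k.rev
  -- Long root: both increments coincide, so `e_k ↦ e_k + 2 sgn k ε e_l`. Since `sgn k * sgn l =
  -- -1`, the coefficient of `e_k` after the second factor is `1 + 4εδ`, which has to vanish.
  · refine ⟨-1 / (4 * ε), fun i q hq => ?_⟩
    have hrl : l.rev = k := by rw [hlk, Fin.rev_rev]
    have hPk : height τ l ≤ i →
        (Pi.single k 1 : Fin (2 * n) → ℂ) ∈ (coordFlag (τ.trans (rootPerm k l)) i).space :=
      fun hh => hP i k (by simpa [rootPerm_apply h] using hh)
    have hPl : height τ k ≤ i →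
        (Pi.single l 1 : Fin (2 * n) → ℂ) ∈ (coordFlag (τ.trans (rootPerm k l)) i).space :=
      fun hh => hP i l (by simpa [rootPerm_apply h, h.symm] using hh)
    have hsgn : sgn l = -sgn k := by rw [hlk, sgn_rev]
    by_cases hqk : q = k
    · subst hqk
      convert Submodule.smul_mem _ (2 * sgn q * ε) (hPl hq) using 1
      rw [rootSL_mulVec_single]
      simp only [← hlk, if_true, Matrix.mulVec_add, Matrix.mulVec_smul, rootSL_mulVec_single]
      simp only [h, h.symm, hrl, if_true, if_false, hsgn, zero_smul, add_zero]
      rcases sgn_eq_one_or q with hs | hs <;> rw [hs] <;> match_scalars <;> field_simp <;> ring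
    · by_cases hql : q = l
      · subst hql
        rw [rootSL_mulVec_single]
        simp only [Matrix.mulVec_add, Matrix.mulVec_smul, rootSL_mulVec_single]
        simp only [h, h.symm, hrl, ← hlk, if_true, if_false, zero_smul, add_zero]
        refine Submodule.add_mem _ (Submodule.add_mem _ (hPl (hkl.trans hq)) ?_) ?_
        · exact Submodule.smul_mem _ _ (hPk hq)
        · exact Submodule.smul_mem _ _ (hPk hq)
      · have hqr : q.rev ≠ l := fun hh => hqk (by rw [← hrl, ← hh, Fin.rev_rev])
        have hqr' : q.rev ≠ k := fun hh => hql (by rw [hlk, ← hh, Fin.rev_rev])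
        rw [rootSL_mulVec_single]
        simp only [hqk, hqr, if_false, zero_smul, add_zero]
        rw [rootSL_mulVec_single]
        simp only [hql, hqr', if_false, zero_smul, add_zero]
        refine hP i q ?_
        rw [rootPerm_apply h]
        simpa [hqk, hql, ← hlk, hrl] using hq
  · have hlk' : k ≠ l.rev := fun hh => hlk (by rw [hh, Fin.rev_rev])
    -- Short root: the coefficient of `e_k` is `1 - sgn k * sgn l * ε * δ`; the choice which kills
    -- it also settles the dual pair.
    refine ⟨sgn k * sgn l / ε, fun i q hq => ?_⟩
    have hPk : height τ l ≤ i →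
        (Pi.single k 1 : Fin (2 * n) → ℂ) ∈ (coordFlag (τ.trans (rootPerm k l)) i).space :=
      fun hh => hP i k (by simpa [rootPerm_apply h] using hh)
    have hPl : height τ k ≤ i →
        (Pi.single l 1 : Fin (2 * n) → ℂ) ∈ (coordFlag (τ.trans (rootPerm k l)) i).space :=
      fun hh => hP i l (by simpa [rootPerm_apply h, h.symm] using hh)
    have hPk' : height τ l.rev ≤ i →
        (Pi.single k.rev 1 : Fin (2 * n) → ℂ) ∈
          (coordFlag (τ.trans (rootPerm k l)) i).space :=
      fun hh => hP i k.rev (by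
        simpa [rootPerm_apply h, hk.symm, Ne.symm hlk] using hh)
    have hPl' : height τ k.rev ≤ i →
        (Pi.single l.rev 1 : Fin (2 * n) → ℂ) ∈
          (coordFlag (τ.trans (rootPerm k l)) i).space :=
      fun hh => hP i l.rev (by
        simpa [rootPerm_apply h, hl.symm, hlk'.symm, hkl'.symm] using hh)
    by_cases hqk : q = k
    · subst hqk
      convert Submodule.smul_mem _ (sgn q * ε) (hPl hq) using 1
      rw [rootSL_mulVec_single]
      simp only [Ne.symm hlk, if_true, if_false, zero_smul, add_zero, Matrix.mulVec_add,
        Matrix.mulVec_smul, rootSL_mulVec_single]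
      simp only [h, hlk'.symm, if_false, hk.symm, zero_smul, add_zero]
      rcases sgn_eq_one_or q with hs | hs <;> rcases sgn_eq_one_or l with hs' | hs' <;>
        rw [hs, hs'] <;> match_scalars <;> field_simp <;> ring
    · by_cases hql : q = l
      · subst hql
        rw [rootSL_mulVec_single]
        simp only [Matrix.mulVec_add, Matrix.mulVec_smul, rootSL_mulVec_single]
        simp only [hlk'.symm, h.symm, hl.symm, if_true, if_false, zero_smul, add_zero]
        exact Submodule.add_mem _ (hPl (hkl.trans hq)) (Submodule.smul_mem _ _ (hPk hq))
      · by_cases hqk' : q = k.rev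
        · subst hqk'
          rw [rootSL_mulVec_single]
          simp only [Fin.rev_rev, hk.symm, h, if_false, zero_smul, add_zero]
          rw [rootSL_mulVec_single]
          simp only [Fin.rev_rev, Ne.symm hlk, if_true, if_false, zero_smul, add_zero]
          exact Submodule.add_mem _ (hPk' (by omega)) (Submodule.smul_mem _ _ (hPl' hq))
        · by_cases hql' : q = l.rev
          · subst hql'
            convert Submodule.smul_mem _ (sgn l.rev * ε) (hPk' hq) using 1
            rw [rootSL_mulVec_single]
            simp only [Fin.rev_rev, hlk'.symm, if_true, if_false, zero_smul, add_zero,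
              Matrix.mulVec_add, Matrix.mulVec_smul, rootSL_mulVec_single]
            simp only [h.symm, Ne.symm hlk, if_false, hl.symm, sgn_rev,
              zero_smul, add_zero]
            rcases sgn_eq_one_or k with hs | hs <;> rcases sgn_eq_one_or l with hs' | hs' <;>
              rw [hs, hs'] <;> match_scalars <;> field_simp <;> ring
          · have hqr : q.rev ≠ l := fun hh => hql' (by rw [← hh, Fin.rev_rev])
            have hqr' : q.rev ≠ k := fun hh => hqk' (by rw [← hh, Fin.rev_rev])
            rw [rootSL_mulVec_single]
            simp only [hqk, hqr, if_false, zero_smul, add_zero]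
            rw [rootSL_mulVec_single]
            simp only [hql, hqr', if_false, zero_smul, add_zero]
            refine hP i q ?_
            rw [rootPerm_apply h]
            simpa [hqk, hql, hqk', hql'] using hq


/-! ### Moving coordinate flags by reflections -/

theorem coordFlag_congr {n : ℕ} {τ τ' : Equiv.Perm (Fin (2 * n))}
    (h : ∀ q, height τ q = height τ' q) : coordFlag τ = coordFlag τ' := by
  funext i
  apply Gr.ext
  rw [coordFlag_space, coordFlag_space]
  simp_rw [h]

/-- The difference of the two sums is `(w l - w k) * (h l - h k)`, the rearrangement inequality for
one transposition. -/
theorem sum_swap_lt {N : ℕ} (w h : Fin N → ℕ) {k l : Fin N} (hw : w k < w l) (hh : h k < h l) :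
    ∑ q, w q * h (Equiv.swap k l q) < ∑ q, w q * h q := by
  have hkl : k ≠ l := by
    rintro rfl
    exact lt_irrefl _ hw
  have key : ∑ q, ((w q : ℤ) * h q - w q * h (Equiv.swap k l q)) =
      (w k * h k - w k * h l) + (w l * h l - w l * h k) := by
    rw [Finset.sum_eq_add k l hkl]
    · simp
    · intro c _ hc
      rw [Equiv.swap_apply_of_ne_of_ne hc.1 hc.2, sub_self]
    · simp
    · simp
  rw [Finset.sum_sub_distrib] at key
  zify at hw hh ⊢
  nlinarith

/-- A weighted sum of the heights. -/
def heightSum {n : ℕ} (w : Fin (2 * n) → ℕ) (τ : Equiv.Perm (Fin (2 * n))) : ℕ :=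
  ∑ q, w q * height τ q

/-- The measure for both inductions along reflections. For a short root the dual transposition also
decreases it, as self-duality reverses heights. -/
theorem heightSum_trans_rootPerm_lt {n : ℕ} {τ : Equiv.Perm (Fin (2 * n))} (hτ : IsSelfDual τ)
    (w : Fin (2 * n) → ℕ) {k l : Fin (2 * n)} (hw : w k < w l) (hw' : w l.rev < w k.rev)
    (hkl : height τ k < height τ l) :
    heightSum w (τ.trans (rootPerm k l)) < heightSum w τ := by
  have hne : k ≠ l := by
    rintro rfl
    exact lt_irrefl _ hw
  have hk := ne_rev k
  have hl := ne_rev l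
  simp only [heightSum, height_trans_rootPerm τ hne]
  have h1 := sum_swap_lt w (height τ) hw hkl
  unfold rootPerm
  split_ifs with hlk
  · exact h1
  · have hlk' : k ≠ l.rev := fun hh => hlk (by rw [hh, Fin.rev_rev])
    refine lt_trans ?_ h1
    have h2 := sum_swap_lt w (fun q => height τ (Equiv.swap k l q)) hw' (by
      rw [Equiv.swap_apply_of_ne_of_ne hlk'.symm hl.symm,
        Equiv.swap_apply_of_ne_of_ne hk.symm (Ne.symm hlk)]
      have h3 := hτ.height_rev k
      have h4 := hτ.height_rev l
      omega)
    rw [Equiv.swap_comm l.rev] at h2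
    exact h2

theorem height_apply {n : ℕ} (τ : Equiv.Perm (Fin (2 * n))) (r : Fin (2 * n)) :
    height τ (τ r) = ((r : ℕ) + 1) / 2 := by
  rw [height, Equiv.symm_apply_apply]

/-- A self-dual coordinate flag in the Schubert variety of `σ_n`, other than that of `σ_n`, admits
a reflection towards the latter. -/
theorem exists_raising_pair {n : ℕ} {τ : Equiv.Perm (Fin (2 * n))} (hτ : IsSelfDual τ)
    (hZ : ∀ q : Fin (2 * n), height τ q ≤ q + 1)
    (hne : ∃ q : Fin (2 * n), (q : ℕ) < n ∧ height τ q ≠ q + 1) :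
    ∃ k l : Fin (2 * n), k < l ∧ height τ k < height τ l ∧ height τ l ≤ k + 1 ∧
      (l : ℕ) ≤ n + height τ k := by
  have hZ' : ∀ q : Fin (2 * n), (q : ℕ) ≤ n + height τ q := by
    intro q
    have h1 := hτ.height_rev q
    have h2 := hZ q.rev
    have h3 := q.2
    rw [Fin.val_rev] at h2
    omega
  obtain ⟨k, ⟨hkn, hk⟩, hkmin⟩ : ∃ k : Fin (2 * n), ((k : ℕ) < n ∧ height τ k ≠ k + 1) ∧
      ∀ q, q < k → height τ q = q + 1 := by
    obtain ⟨k, hk, hmin⟩ := wellFounded_lt.has_min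
      {q : Fin (2 * n) | (q : ℕ) < n ∧ height τ q ≠ q + 1} hne
    refine ⟨k, hk, fun q hq => ?_⟩
    by_contra h
    exact hmin q ⟨(Fin.lt_def.1 hq).trans hk.1, h⟩ hq
  have hki := hZ k
  refine ⟨k, ?_⟩
  by_contra! hcon
  set i := height τ k with hi
  -- The positions `2i+1, …, 2k+2` are those of height in `(i, k+1]`. A basis vector there has index
  -- either below `k`, hence in `[i, k)` by minimality of `k`, or above `k`, hence in `[n+i+1,
  -- n+k+1]` if no suitable `l` exists. That leaves one index too few; the minima with `2n-1` treat
  -- the case `k = n-1`.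
  have hcard := Finset.card_le_card_of_injOn
    (s := Finset.univ.filter fun r : Fin (2 * n) => 2 * i + 1 ≤ (r : ℕ) ∧ (r : ℕ) ≤ 2 * k + 2)
    (t := Finset.Ico i (k : ℕ) ∪ Finset.Icc (n + i + 1) (min (n + k + 1) (2 * n - 1)))
    (fun r => (τ r : ℕ)) (by
      intro r hr
      have hr' := Finset.mem_filter.1 (Finset.mem_coe.1 hr)
      have hht := height_apply τ r
      have h1 := hZ (τ r)
      have h2 := hZ' (τ r)
      have h3 := (τ r).2
      beta_reduce
      rw [Finset.mem_coe, Finset.mem_union, Finset.mem_Ico, Finset.mem_Icc]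
      rcases lt_trichotomy (τ r) k with h | h | h
      · left
        have := Fin.lt_def.1 h
        omega
      · rw [h, ← hi] at hht
        omega
      · right
        have h5 := hcon (τ r) h (by omega) (by omega)
        omega)
    (by
      intro a _ b _ hab
      exact τ.injective (Fin.ext hab))
  have hc1 : (Finset.univ.filter fun r : Fin (2 * n) =>
      2 * i + 1 ≤ (r : ℕ) ∧ (r : ℕ) ≤ 2 * k + 2).card =
      (Finset.Icc (2 * i + 1) (min (2 * k + 2) (2 * n - 1))).card := by
    rw [← Finset.card_map Fin.valEmbedding]
    congr 1
    ext r
    simp only [Finset.mem_map, Finset.mem_filter, Finset.mem_univ, true_and, Fin.valEmbedding_apply,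
      Finset.mem_Icc]
    constructor
    · rintro ⟨a, ha, rfl⟩
      omega
    · intro hr
      exact ⟨⟨r, by omega⟩, by simp only; omega, rfl⟩
  have hc2 := Finset.card_union_le (Finset.Ico i (k : ℕ))
    (Finset.Icc (n + i + 1) (min (n + k + 1) (2 * n - 1)))
  rw [hc1] at hcard
  simp only [Nat.card_Icc, Nat.card_Ico] at hcard hc2
  omega

theorem height_sigma_of_lt {n : ℕ} {q : Fin (2 * n)} (h : (q : ℕ) < n) :
    height (sigma n) q = q + 1 := by
  have : ((sigma n).symm q : ℕ) = 2 * q + 1 := by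
    change ((if h : (q : ℕ) < n then (⟨2 * q + 1, _⟩ : Fin (2 * n)) else _ : Fin (2 * n)) : ℕ) = _
    rw [dif_pos h]
  rw [height, this]
  omega

theorem height_sigma_of_le {n : ℕ} {q : Fin (2 * n)} (h : n ≤ (q : ℕ)) :
    height (sigma n) q = q - n := by
  have : ((sigma n).symm q : ℕ) = 2 * (q - n) := by
    change ((if h : (q : ℕ) < n then _ else (⟨2 * (q - n), _⟩ : Fin (2 * n)) : Fin (2 * n)) : ℕ) = _
    rw [dif_neg (not_lt_of_ge h)]
  rw [height, this]
  omega

theorem isSelfDual_sigma (n : ℕ) : IsSelfDual (sigma n) := by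
  intro r
  have hr := r.2
  apply Fin.ext
  simp only [sigma, Equiv.coe_fn_mk, Fin.val_rev]
  split_ifs <;> simp only <;> omega

/-- The coordinate flags in the Schubert variety of `σ_n` lie in the closure of the symplectic
cell. -/
theorem smul_coordFlag_mem_spSchubertVariety {n : ℕ} (τ : Equiv.Perm (Fin (2 * n)))
    (hτ : IsSelfDual τ) (hZ : ∀ q : Fin (2 * n), height τ q ≤ q + 1) (g : SL n)
    (hg : g ∈ spBorel n) : g • coordFlag τ ∈ spSchubertVariety (sigma n) := by
  by_cases hne : ∃ q : Fin (2 * n), (q : ℕ) < n ∧ height τ q ≠ q + 1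
  · obtain ⟨k, l, hkl, hht, hl1, hl2⟩ := exists_raising_pair hτ hZ hne
    have hdec := heightSum_trans_rootPerm_lt hτ (fun q => (q : ℕ)) hkl
      (Fin.rev_lt_rev.2 hkl) hht
    have hτ' : IsSelfDual (τ.trans (rootPerm k l)) := hτ.trans_rootPerm hkl.ne
    -- The condition `height τ l ≤ k + 1` gives the bound at `k`, and `l ≤ n + height τ k` is the
    -- bound at `l.rev` in dual form.
    have hZ' : ∀ q : Fin (2 * n), height (τ.trans (rootPerm k l)) q ≤ q + 1 := by
      intro q
      have hq := hZ q
      have h1 := hτ.height_rev k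
      have h2 := hτ.height_rev l
      have h3 := Fin.lt_def.1 hkl
      have h4 := l.2
      rw [height_trans_rootPerm τ hkl.ne, rootPerm_apply hkl.ne]
      split_ifs with hk hl hkr hlr
      · rwa [hk]
      · rw [hl]
        omega
      · rw [hkr, Fin.val_rev]
        omega
      · rw [hlr, Fin.val_rev]
        omega
      · exact hq
    rintro Z ⟨hZc, hcell⟩
    -- For `ε ≠ 0` the curve lies in the `B^ι`-orbit of the reflected flag, because the opposite
    -- root element is upper triangular; at `ε = 0` it passes through the given point.
    have hlim := mem_of_curve hZc (fun ε => g * rootSL hkl.ne ε)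
      (continuous_const.matrix_mul (continuous_rootSL hkl.ne)) (coordFlag τ) (by
        intro ε hε
        obtain ⟨δ, hδ⟩ := exists_rootSL_smul_eq hτ hkl.ne hht.le hε
        rw [mul_smul, hδ, ← mul_smul]
        exact smul_coordFlag_mem_spSchubertVariety _ hτ' hZ' _
          ((spBorel n).mul_mem hg (rootSL_mem_spBorel hkl δ)) Z ⟨hZc, hcell⟩)
    simpa [rootSL_zero] using hlim
  · push Not at hne
    apply subset_zariskiClosure
    refine ⟨g, hg, ?_⟩
    congr 1
    refine coordFlag_congr fun q => ?_
    by_cases hq : (q : ℕ) < n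
    · rw [hne q hq, height_sigma_of_lt hq]
    · have h1 := hne q.rev (by rw [Fin.val_rev]; omega)
      have h2 := hτ.height_rev q
      rw [Fin.val_rev] at h1
      rw [height_sigma_of_le (not_lt.1 hq)]
      omega
termination_by heightSum (fun q => (q : ℕ)) τ

/-- Every self-dual coordinate flag is `Sp_{2n}`-conjugate to the standard flag. -/
theorem exists_Sp_smul_coordFlag_one {n : ℕ} (τ : Equiv.Perm (Fin (2 * n)))
    (hτ : IsSelfDual τ) : ∃ g ∈ Sp n, coordFlag τ = g • coordFlag (n := n) 1 := by
  by_cases hmono : ∃ k l : Fin (2 * n), l < k ∧ height τ k < height τ l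
  · obtain ⟨k, l, hkl, hht⟩ := hmono
    have hdec := heightSum_trans_rootPerm_lt hτ (fun q => (q.rev : ℕ)) (Fin.rev_lt_rev.2 hkl)
      (by simpa only [Fin.rev_rev] using Fin.lt_def.1 hkl) hht
    obtain ⟨g, hg, hgτ⟩ := exists_Sp_smul_coordFlag_one (τ.trans (rootPerm k l))
      (hτ.trans_rootPerm hkl.ne')
    obtain ⟨δ, hδ⟩ := exists_rootSL_smul_eq hτ hkl.ne' hht.le (one_ne_zero (α := ℂ))
    refine ⟨(rootSL hkl.ne' 1)⁻¹ * rootSL hkl.ne δ * g, (Sp n).mul_mem ((Sp n).mul_mem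
      ((Sp n).inv_mem (rootSL_mem_Sp _ _)) (rootSL_mem_Sp _ _)) hg, ?_⟩
    rw [mul_smul, ← hgτ, mul_smul, ← hδ, inv_smul_smul]
  -- Heights now increase weakly with the index. If `e_q` lay in the `i`-th member with `q > 2i`, so
  -- would all earlier basis vectors, exceeding the dimension `2i+1`.
  · push Not at hmono
    refine ⟨1, (Sp n).one_mem, ?_⟩
    rw [one_smul]
    funext i
    apply Gr.eq_of_le
    rw [coordFlag_space, coordFlag_space, coordSub_le_iff]
    intro q hq
    rw [single_mem_coordSub]
    change ((q : ℕ) + 1) / 2 ≤ i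
    by_contra hlt
    have hq' : height τ q ≤ i := hq
    have hcard := Finset.card_le_card_of_injOn (s := Finset.Iic q)
      (t := Finset.range (2 * (i : ℕ) + 1)) (fun p => (τ.symm p : ℕ)) (by
        intro p hp
        have hp' : p ≤ q := by simpa using hp
        have h1 : height τ p ≤ i := by
          rcases hp'.lt_or_eq with h | h
          · exact (hmono q p h).trans hq'
          · rwa [h]
        unfold height at h1
        simp only [Finset.coe_range, Set.mem_Iio]
        omega)
      (by
        intro a _ b _ hab
        exact τ.symm.injective (Fin.ext hab))
    rw [Fin.card_Iic, Finset.card_range] at hcard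
    omega
termination_by heightSum (fun q => (q.rev : ℕ)) τ


/-! ### The symplectic Schubert variety -/

/-- The flags with `⟨e_1, …, e_{i-1}⟩ ⊆ W_i ⊆ ⟨e_1, …, e_{n+i}⟩` for all `i`. -/
def boundedFlags (n : ℕ) : Set (AmbW n) :=
  {x | x ∈ flagVariety n ∧ ∀ i : Fin n, coordSub {q | (q : ℕ) < i} ≤ (x i).space ∧
    (x i).space ≤ coordSub {q | (q : ℕ) < n + 1 + i}}

theorem isZariskiClosed_boundedFlags (n : ℕ) : IsZariskiClosed (boundedFlags n) := by
  have : boundedFlags n = flagVariety n ∩ ⋂ i : Fin n,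
      (⋂ (q : Fin (2 * n)) (_ : (q : ℕ) < i), {x : AmbW n | Pi.single q 1 ∈ (x i).space}) ∩
      (⋂ (q : Fin (2 * n)) (_ : ¬ (q : ℕ) < n + 1 + i),
        {x : AmbW n | ∀ w ∈ (x i).space, w q = 0}) := by
    ext x
    simp only [boundedFlags, Set.mem_ofPred_eq, Set.mem_inter_iff, Set.mem_iInter, coordSub_le_iff]
    refine and_congr_right fun _ => forall_congr' fun i => and_congr_right fun _ => ?_
    exact ⟨fun h q hq w hw => h hw q hq, fun h w hw q hq => h q hq w hw⟩
  rw [this]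
  exact (isZariskiClosed_flagVariety n).inter (IsZariskiClosed.iInter fun i =>
    (IsZariskiClosed.iInter fun q => IsZariskiClosed.iInter fun _ => isZariskiClosed_mem i _).inter
      (IsZariskiClosed.iInter fun q => IsZariskiClosed.iInter fun _ =>
        isZariskiClosed_le_ker i q))

theorem borel_mulVec_mem {n : ℕ} {g : SL n} (hg : g ∈ borel n) {a : ℕ} {v : Fin (2 * n) → ℂ}
    (hv : v ∈ coordSub {q : Fin (2 * n) | (q : ℕ) < a}) :
    g.1.mulVec v ∈ coordSub {q : Fin (2 * n) | (q : ℕ) < a} := by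
  intro q hq
  rw [Matrix.mulVec, dotProduct]
  refine Finset.sum_eq_zero fun l _ => ?_
  by_cases hl : l < q
  · rw [hg q l hl, zero_mul]
  · rw [hv l, mul_zero]
    have hq' : ¬ (q : ℕ) < a := hq
    change ¬ (l : ℕ) < a
    rw [Fin.lt_def] at hl
    omega

theorem smul_mem_boundedFlags {n : ℕ} {g : SL n} (hg : g ∈ borel n) {x : AmbW n}
    (hx : x ∈ boundedFlags n) : g • x ∈ boundedFlags n := by
  refine ⟨smul_mem_flagVariety hx.1, fun i => ⟨fun v hv => ?_, ?_⟩⟩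
  · rw [mem_smul_iff]
    exact (hx.2 i).1 (borel_mulVec_mem (borel_inv_mem hg) hv)
  · rintro _ ⟨v, hv, rfl⟩
    exact borel_mulVec_mem hg ((hx.2 i).2 hv)

theorem coordFlag_mem_flagVariety {n : ℕ} (τ : Equiv.Perm (Fin (2 * n))) :
    coordFlag τ ∈ flagVariety n := by
  intro i j hij
  rw [coordFlag_space, coordSub_le_iff]
  intro q hq
  exact single_mem_coordFlag.2 (le_trans hq hij)

theorem coordFlag_sigma_mem (n : ℕ) : coordFlag (sigma n) ∈ boundedFlags n := by
  refine ⟨coordFlag_mem_flagVariety _, fun i => ⟨?_, ?_⟩⟩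
  · rw [coordSub_le_iff]
    intro q hq
    have hq' : (q : ℕ) < i := hq
    rw [single_mem_coordFlag, height_sigma_of_lt (by omega)]
    omega
  · rw [coordFlag_space, coordSub_le_iff]
    intro q hq
    rw [single_mem_coordSub]
    change (q : ℕ) < n + 1 + i
    have hq' : height (sigma n) q ≤ i := hq
    by_cases h : (q : ℕ) < n
    · omega
    · rw [height_sigma_of_le (not_lt.1 h)] at hq'
      omega

theorem schubertVariety_subset_boundedFlags (n : ℕ) :
    schubertVariety (sigma n) ⊆ boundedFlags n := by
  refine zariskiClosure_subset (isZariskiClosed_boundedFlags n) ?_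
  rintro _ ⟨g, hg, rfl⟩
  exact smul_mem_boundedFlags hg (coordFlag_sigma_mem n)

theorem exists_coordFlag_of_mem {m n : ℕ} (hm : 1 ≤ m) (hn : n = 2 * m - 1) {x : AmbW n}
    (hx : x ∈ boundedFlags n ∩ iotaFixed (formW n)) :
    ∃ g ∈ spBorel n, ∃ τ : Equiv.Perm (Fin (2 * n)), IsSelfDual τ ∧
      (∀ q : Fin (2 * n), height τ q ≤ q + 1) ∧ x = g • coordFlag τ := by
  obtain ⟨g, hg, τ, hτ, hgx⟩ := exists_spBorel_smul_eq_coordFlag hm hn hx.1.1 hx.2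
  refine ⟨g⁻¹, (spBorel n).inv_mem hg, τ, hτ, fun q => ?_, by rw [← hgx, inv_smul_smul]⟩
  -- The lower bound on the member with zero-based index `q + 1` applies when that member exists;
  -- otherwise every height is at most `n ≤ q + 1`.
  by_cases hq : (q : ℕ) + 1 < n
  · have h1 := smul_mem_boundedFlags hg.1 hx.1
    rw [hgx] at h1
    have h2 := coordSub_le_iff.1 (h1.2 ⟨q + 1, hq⟩).1 q (Nat.lt_succ_self _)
    exact single_mem_coordFlag.1 h2
  · unfold height
    omega

theorem spSchubertVariety_subset (n : ℕ) :
    spSchubertVariety (sigma n) ⊆ schubertVariety (sigma n) ∩ iotaFixed (formW n) := by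
  refine Set.subset_inter (zariskiClosure_mono ?_) (zariskiClosure_subset
    (isZariskiClosed_iotaFixed _ (formW_nondegenerate n) dim_add_dim_rev) ?_)
  · rintro _ ⟨g, hg, rfl⟩
    exact ⟨g, hg.1, rfl⟩
  · rintro _ ⟨g, hg, rfl⟩
    exact smul_mem_iotaFixed hg.2 (isSelfDual_sigma n).coordFlag_mem

theorem boundedFlags_inter_subset {m n : ℕ} (hm : 1 ≤ m) (hn : n = 2 * m - 1) :
    boundedFlags n ∩ iotaFixed (formW n) ⊆ spSchubertVariety (sigma n) := by
  intro x hx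
  obtain ⟨g, hg, τ, hτ, hZ, rfl⟩ := exists_coordFlag_of_mem hm hn hx
  exact smul_coordFlag_mem_spSchubertVariety τ hτ hZ g hg

/-- The symplectic Schubert variety lies in the left side and contains the right side, which closes
the circle of inclusions. -/
theorem schubertVariety_inter_eq_boundedFlags_inter {m n : ℕ} (hm : 1 ≤ m) (hn : n = 2 * m - 1) :
    schubertVariety (sigma n) ∩ iotaFixed (formW n) =
      boundedFlags n ∩ iotaFixed (formW n) :=
  Set.Subset.antisymm
    (Set.inter_subset_inter_left _ (schubertVariety_subset_boundedFlags n))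
    ((boundedFlags_inter_subset hm hn).trans (spSchubertVariety_subset n))

theorem schubertVariety_inter_eq {m n : ℕ} (hm : 1 ≤ m) (hn : n = 2 * m - 1) :
    schubertVariety (sigma n) ∩ iotaFixed (formW n) = spSchubertVariety (sigma n) := by
  refine Set.Subset.antisymm ?_ (spSchubertVariety_subset n)
  rw [schubertVariety_inter_eq_boundedFlags_inter hm hn]
  exact boundedFlags_inter_subset hm hn

theorem boundedFlags_inter_subset_range {m n : ℕ} (hm : 1 ≤ m) (hn : n = 2 * m - 1) :
    boundedFlags n ∩ iotaFixed (formW n) ⊆ Set.range (embQ n) := by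
  intro x hx
  obtain ⟨g, hg, τ, hτ, -, rfl⟩ := exists_coordFlag_of_mem hm hn hx
  obtain ⟨g', hg', h⟩ := exists_Sp_smul_coordFlag_one τ hτ
  refine ⟨QuotientGroup.mk ⟨g * g', (Sp n).mul_mem hg.2 hg'⟩, ?_⟩
  rw [h, ← mul_smul]
  rfl

/-! ### The torus action -/

theorem exists_torusActW_eq_smul {n : ℕ} {t : Fin (2 * n) → ℂˣ} (ht : t ∈ torusIota n) :
    ∃ g ∈ spBorel n, ∀ x : AmbW n, torusActW t x = g • x := by
  have hdet : (Matrix.diagonal fun k => (t k : ℂ)).det = 1 := by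
    rw [Matrix.det_diagonal, ← Units.coe_prod, ht.1, Units.val_one]
  have hdiag : ∀ v, diagAut t v = (Matrix.diagonal fun k => (t k : ℂ)).mulVec v := by
    intro v
    funext k
    rw [Matrix.mulVec_diagonal]
    rfl
  refine ⟨⟨Matrix.diagonal fun k => (t k : ℂ), hdet⟩, ⟨?_, ?_⟩, fun x => ?_⟩
  · intro k l hkl
    exact Matrix.diagonal_apply_ne' _ hkl.ne
  · intro v w
    have := ht.2 v w
    rw [hdiag, hdiag] at this
    exact this
  · funext i
    apply Gr.ext
    change (x i).space.map _ = (x i).space.map _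
    congr 1
    exact LinearMap.ext hdiag

/-! ### The embedding of the degenerate flag variety -/

/-- The index of the coordinate of `W` which corresponds to `f_k` in the `i`-th copy of `V`. -/
def win {n : ℕ} (i : Fin n) (k : Fin (n + 1)) : Fin (2 * n) :=
  if h : (i : ℕ) ≤ k then ⟨k, by omega⟩ else ⟨n + 1 + k, by omega⟩

theorem val_win {n : ℕ} (i : Fin n) (k : Fin (n + 1)) :
    (win i k : ℕ) = if (i : ℕ) ≤ k then (k : ℕ) else n + 1 + k := by
  unfold win
  split_ifs <;> rfl

/-- The inverse of `win`. -/
def winInv {n : ℕ} (q : Fin (2 * n)) : Fin (n + 1) :=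
  if h : (q : ℕ) ≤ n then ⟨q, by omega⟩ else ⟨q - (n + 1), by omega⟩

theorem val_winInv {n : ℕ} (q : Fin (2 * n)) :
    (winInv q : ℕ) = if (q : ℕ) ≤ n then (q : ℕ) else q - (n + 1) := by
  unfold winInv
  split_ifs <;> rfl

theorem winInv_win {n : ℕ} (i : Fin n) (k : Fin (n + 1)) : winInv (win i k) = k := by
  apply Fin.ext
  rw [val_winInv, val_win]
  split_ifs <;> omega

theorem win_winInv {n : ℕ} (i : Fin n) {q : Fin (2 * n)} (h : (i : ℕ) ≤ q)
    (h' : (q : ℕ) < n + 1 + i) : win i (winInv q) = q := by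
  apply Fin.ext
  rw [val_win, val_winInv]
  split_ifs <;> omega

theorem le_win {n : ℕ} (i : Fin n) (k : Fin (n + 1)) : (i : ℕ) ≤ win i k := by
  rw [val_win]
  split_ifs <;> omega

theorem win_lt {n : ℕ} (i : Fin n) (k : Fin (n + 1)) : (win i k : ℕ) < n + 1 + i := by
  rw [val_win]
  split_ifs <;> omega

/-- The map `f_k ↦ c_{win i k} e_{win i k}` of `V` into `W`. -/
def winMap {n : ℕ} (c : Fin (2 * n) → ℂ) (i : Fin n) :
    (Fin (n + 1) → ℂ) →ₗ[ℂ] (Fin (2 * n) → ℂ) :=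
  LinearMap.pi fun q =>
    if (i : ℕ) ≤ q ∧ (q : ℕ) < n + 1 + i then c q • LinearMap.proj (winInv q) else 0

theorem winMap_win {n : ℕ} (c : Fin (2 * n) → ℂ) (i : Fin n) (v : Fin (n + 1) → ℂ)
    (k : Fin (n + 1)) : winMap c i v (win i k) = c (win i k) * v k := by
  rw [winMap, LinearMap.pi_apply, if_pos ⟨le_win i k, win_lt i k⟩, LinearMap.smul_apply,
    LinearMap.proj_apply, winInv_win, smul_eq_mul]

theorem winMap_eq_zero {n : ℕ} (c : Fin (2 * n) → ℂ) (i : Fin n) (v : Fin (n + 1) → ℂ)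
    {q : Fin (2 * n)} (h : ¬((i : ℕ) ≤ q ∧ (q : ℕ) < n + 1 + i)) : winMap c i v q = 0 := by
  rw [winMap, LinearMap.pi_apply, if_neg h, LinearMap.zero_apply]

theorem win_injective {n : ℕ} (i : Fin n) : Function.Injective (win i) := fun k l h => by
  rw [← winInv_win i k, h, winInv_win]

theorem winMap_single {n : ℕ} (c : Fin (2 * n) → ℂ) (i : Fin n) (k : Fin (n + 1)) :
    winMap c i (Pi.single k 1) = c (win i k) • Pi.single (win i k) 1 := by
  funext q
  by_cases h : (i : ℕ) ≤ q ∧ (q : ℕ) < n + 1 + i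
  · rw [← win_winInv i h.1 h.2, winMap_win, Pi.smul_apply, smul_eq_mul]
    by_cases hk : winInv q = k
    · subst hk
      simp
    · rw [Pi.single_eq_of_ne hk, Pi.single_eq_of_ne fun h => hk (win_injective i h), mul_zero,
        mul_zero]
  · rw [winMap_eq_zero c i _ h, Pi.smul_apply, Pi.single_eq_of_ne, smul_zero]
    rintro rfl
    exact h ⟨le_win i k, win_lt i k⟩

/-- The subspace `⟨e_1, …, e_{i-1}⟩` of `W`. -/
def lowerSub {n : ℕ} (i : Fin n) : Submodule ℂ (Fin (2 * n) → ℂ) :=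
  coordSub {q | (q : ℕ) < i}

/-- The subspace `⟨e_1, …, e_{n+i}⟩` of `W`. -/
def upperSub {n : ℕ} (i : Fin n) : Submodule ℂ (Fin (2 * n) → ℂ) :=
  coordSub {q | (q : ℕ) < n + 1 + i}

theorem finrank_lowerSub {n : ℕ} (i : Fin n) : finrank ℂ (lowerSub i) = i := by
  have h : ({q | (q : ℕ) < i} : Set (Fin (2 * n))) =
      ((Finset.Iio (⟨i, by omega⟩ : Fin (2 * n)) : Finset (Fin (2 * n))) : Set (Fin (2 * n))) := by
    ext q
    simp [Fin.lt_def]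
  rw [lowerSub, h, finrank_coordSub, Fin.card_Iio]

section

variable {n : ℕ} {c : Fin (2 * n) → ℂ}

theorem eq_zero_of_winMap_mem (hc : ∀ q, c q ≠ 0) (i : Fin n) {v : Fin (n + 1) → ℂ}
    (h : winMap c i v ∈ lowerSub i) : v = 0 := by
  funext k
  have h1 := h (win i k) (not_lt_of_ge (le_win i k))
  rw [winMap_win] at h1
  exact (mul_eq_zero.1 h1).resolve_left (hc _)

theorem winMap_injective (hc : ∀ q, c q ≠ 0) (i : Fin n) : Function.Injective (winMap c i) := by
  rw [← LinearMap.ker_eq_bot, LinearMap.ker_eq_bot']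
  intro v hv
  exact eq_zero_of_winMap_mem hc i (by rw [hv]; exact Submodule.zero_mem _)

theorem lowerSub_inf_map (hc : ∀ q, c q ≠ 0) (i : Fin n) (V : Submodule ℂ (Fin (n + 1) → ℂ)) :
    lowerSub i ⊓ V.map (winMap c i) = ⊥ := by
  rw [eq_bot_iff]
  rintro _ ⟨h1, v, -, rfl⟩
  rw [eq_zero_of_winMap_mem hc i h1, map_zero]
  exact Submodule.zero_mem _

theorem finrank_lowerSub_sup_map (hc : ∀ q, c q ≠ 0) (i : Fin n)
    (V : Submodule ℂ (Fin (n + 1) → ℂ)) :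
    finrank ℂ (lowerSub i ⊔ V.map (winMap c i) : Submodule ℂ (Fin (2 * n) → ℂ)) =
      i + finrank ℂ V := by
  have h := Submodule.finrank_sup_add_finrank_inf_eq (lowerSub i) (V.map (winMap c i))
  rw [lowerSub_inf_map hc, finrank_bot, add_zero, finrank_lowerSub,
    ← (Submodule.equivMapOfInjective _ (winMap_injective hc i) V).finrank_eq] at h
  exact h

/-- The map `(V_i) ↦ (⟨e_1, …, e_{i-1}⟩ ⊕ π_i(V_i))`, where `π_i` is `winMap c i`. -/
def zeta (hc : ∀ q, c q ≠ 0) (x : AmbV n) : AmbW n := fun i =>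
  ⟨lowerSub i ⊔ (x i).space.map (winMap c i), by
    rw [finrank_lowerSub_sup_map hc, (x i).finrank_space]
    change (i : ℕ) + (i + 1) = 2 * i + 1
    omega⟩

theorem zeta_space (hc : ∀ q, c q ≠ 0) (x : AmbV n) (i : Fin n) :
    (zeta hc x i).space = lowerSub i ⊔ (x i).space.map (winMap c i) := rfl

theorem lowerSub_le_zeta (hc : ∀ q, c q ≠ 0) (x : AmbV n) (i : Fin n) :
    lowerSub i ≤ (zeta hc x i).space := le_sup_left

theorem winMap_mem_upperSub (i : Fin n) (v : Fin (n + 1) → ℂ) : winMap c i v ∈ upperSub i :=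
  fun _ hq => winMap_eq_zero c i v fun h => hq h.2

theorem zeta_le_upperSub (hc : ∀ q, c q ≠ 0) (x : AmbV n) (i : Fin n) :
    (zeta hc x i).space ≤ upperSub i := by
  rw [zeta_space, sup_le_iff]
  constructor
  · intro v hv q hq
    refine hv q fun h => hq ?_
    have h' : (q : ℕ) < i := h
    change (q : ℕ) < n + 1 + i
    omega
  · rintro _ ⟨v, -, rfl⟩
    exact winMap_mem_upperSub i v

theorem winMap_mem_zeta (hc : ∀ q, c q ≠ 0) (x : AmbV n) (i : Fin n) {v : Fin (n + 1) → ℂ} :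
    winMap c i v ∈ (zeta hc x i).space ↔ v ∈ (x i).space := by
  constructor
  · intro h
    obtain ⟨e, he, _, ⟨v', hv', rfl⟩, hev⟩ := Submodule.mem_sup.1 h
    have h1 : winMap c i (v - v') = e := by rw [map_sub, ← hev, add_sub_cancel_right]
    have h2 := eq_zero_of_winMap_mem hc i (h1 ▸ he)
    rwa [sub_eq_zero.1 h2]
  · intro h
    exact Submodule.mem_sup_right ⟨v, h, rfl⟩

theorem zeta_injective (hc : ∀ q, c q ≠ 0) : Function.Injective (zeta hc) := by
  intro x y h
  funext i
  apply Gr.ext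
  ext v
  rw [← winMap_mem_zeta hc x, ← winMap_mem_zeta hc y, h]

/-- Under the bounds a vector of the `i`-th member agrees with its part in the window modulo
`lowerSub i`. The member is therefore recovered from its preimage under `winMap`. -/
theorem exists_zeta_eq (hc : ∀ q, c q ≠ 0) {y : AmbW n}
    (hy : ∀ i, lowerSub i ≤ (y i).space ∧ (y i).space ≤ upperSub i) : ∃ x, zeta hc x = y := by
  have hdec : ∀ i, lowerSub i ⊔ ((y i).space.comap (winMap c i)).map (winMap c i) =
      (y i).space := by
    intro i
    apply le_antisymm
    · exact sup_le (hy i).1 (Submodule.map_comap_le _ _)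
    · intro w hw
      let v : Fin (n + 1) → ℂ := fun k => (c (win i k))⁻¹ * w (win i k)
      have hv : w - winMap c i v ∈ lowerSub i := by
        intro q hq
        have hq' : (i : ℕ) ≤ q := not_lt.1 hq
        by_cases h : (q : ℕ) < n + 1 + i
        · rw [← win_winInv i hq' h, Pi.sub_apply, winMap_win, mul_inv_cancel_left₀ (hc _), sub_self]
        · rw [Pi.sub_apply, winMap_eq_zero c i v (fun hh => h hh.2), (hy i).2 hw q h, sub_self]
      have hv' : winMap c i v ∈ (y i).space := by
        have := Submodule.sub_mem _ hw ((hy i).1 hv)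
        rwa [sub_sub_cancel] at this
      rw [← sub_add_cancel w (winMap c i v)]
      exact Submodule.add_mem_sup hv ⟨v, hv', rfl⟩
  refine ⟨fun i => ⟨(y i).space.comap (winMap c i), ?_⟩, funext fun i => Gr.ext (hdec i)⟩
  have h := finrank_lowerSub_sup_map hc i ((y i).space.comap (winMap c i))
  rw [hdec, Gr.finrank_space] at h
  change 2 * (i : ℕ) + 1 = i + _ at h
  change _ = (i : ℕ) + 1
  omega

/-- The two windows share all coordinates but the one lost at `i` and the one gained at `n + 1 + i`.
Both belong to the vector killed by `pr`, so only the lost coordinate survives in the difference,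
and it lies in `lowerSub j`. This is the origin of the degenerate relations. -/
theorem winMap_sub_winMap_pr (i j : Fin n) (hij : (j : ℕ) = i + 1) (v : Fin (n + 1) → ℂ) :
    winMap c i v - winMap c j (pr (Fin.castSucc i) v) ∈ lowerSub j := by
  intro q hq
  have hq' : (j : ℕ) ≤ q := not_lt.1 hq
  simp only [Pi.sub_apply, winMap, LinearMap.pi_apply]
  have hne : (q : ℕ) < n + 1 + i → winInv q ≠ Fin.castSucc i := by
    intro h h2
    have h3 := congrArg Fin.val h2
    rw [val_winInv, Fin.val_castSucc] at h3
    split_ifs at h3 <;> omega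
  by_cases h : (q : ℕ) < n + 1 + i
  · rw [if_pos ⟨by omega, h⟩, if_pos ⟨hq', by omega⟩]
    simp [pr, hne h]
  · rw [if_neg (fun hh => h hh.2)]
    by_cases h2 : (q : ℕ) < n + 1 + j
    · rw [if_pos ⟨hq', h2⟩]
      have h3 : winInv q = Fin.castSucc i := by
        apply Fin.ext
        rw [val_winInv, Fin.val_castSucc]
        split_ifs <;> omega
      simp [pr, h3]
    · rw [if_neg (fun hh => h2 hh.2)]
      simp

theorem zeta_mem_flagVariety_iff (hc : ∀ q, c q ≠ 0) (x : AmbV n) :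
    zeta hc x ∈ flagVariety n ↔ x ∈ degFlag n := by
  constructor
  · rintro h i j hij _ ⟨v, hv, rfl⟩
    rw [← winMap_mem_zeta hc]
    have h1 := h i j (by rw [Fin.le_def]; omega) ((winMap_mem_zeta hc x i).2 hv)
    have h2 := Submodule.sub_mem _ h1
      (lowerSub_le_zeta hc x j (winMap_sub_winMap_pr (c := c) i j hij v))
    rwa [sub_sub_cancel] at h2
  · intro h
    have hstep : ∀ i j : Fin n, (j : ℕ) = i + 1 → (zeta hc x i).space ≤ (zeta hc x j).space := by
      intro i j hij
      rw [zeta_space, sup_le_iff]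
      constructor
      · refine le_trans ?_ (lowerSub_le_zeta hc x j)
        intro v hv q hq
        have hq' : (j : ℕ) ≤ q := not_lt.1 hq
        refine hv q (not_lt_of_ge (α := ℕ) ?_)
        omega
      · rintro _ ⟨v, hv, rfl⟩
        have h1 := h i j hij ⟨v, hv, rfl⟩
        have h2 := Submodule.add_mem _
          (lowerSub_le_zeta hc x j (winMap_sub_winMap_pr (c := c) i j hij v))
          ((winMap_mem_zeta hc x j).2 h1)
        rwa [sub_add_cancel] at h2
    have hall : ∀ (r : ℕ) (i j : Fin n), (j : ℕ) = i + r →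
        (zeta hc x i).space ≤ (zeta hc x j).space := by
      intro r
      induction r with
      | zero =>
        intro i j hij
        rw [Fin.ext hij]
      | succ r ih =>
        intro i j hij
        exact (ih i ⟨i + r, by omega⟩ rfl).trans (hstep _ j hij)
    intro i j hij
    exact hall (j - i) i j (by rw [Fin.le_def] at hij; omega)

/-- Reversal of indices carries the first `i` coordinates outside the first `2n-i`. The summands
`lowerSub` are therefore invisible to the pairing of dual members, which reduces to that of the
windows. -/
theorem formW_lower_upper (i : Fin n) {u e : Fin (2 * n) → ℂ} (hu : u ∈ upperSub (Fin.rev i))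
    (he : e ∈ lowerSub i) : formW n u e = 0 := by
  rw [formW_apply]
  refine Finset.sum_eq_zero fun k _ => ?_
  by_cases hk : (k : ℕ) < n + 1 + (Fin.rev i : Fin n)
  · rw [he k.rev, mul_zero]
    refine not_lt_of_ge (α := ℕ) ?_
    rw [Fin.val_rev] at hk ⊢
    omega
  · rw [hu k hk, mul_zero, zero_mul]

theorem zeta_mem_iotaFixed_iff (hc : ∀ q, c q ≠ 0)
    {b : LinearMap.BilinForm ℂ (Fin (n + 1) → ℂ)} (hb : b.Nondegenerate)
    (hbc : ∀ (i : Fin n) v w, formW n (winMap c (Fin.rev i) v) (winMap c i w) = b v w)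
    (x : AmbV n) : zeta hc x ∈ iotaFixed (formW n) ↔ x ∈ iotaFixed b := by
  rw [iotaFixed_formW_eq, iotaFixed_eq b hb (fun i => by rw [Fin.val_rev]; omega)]
  simp only [Set.mem_iInter, Set.mem_ofPred_eq]
  refine forall_congr' fun i => ⟨fun h v hv v' hv' => ?_, fun h w hw w' hw' => ?_⟩
  · change b v' v = 0
    rw [← hbc i]
    exact h ((winMap_mem_zeta hc x i).2 hv) _ ((winMap_mem_zeta hc x i.rev).2 hv')
  · change formW n w' w = 0
    have hu := zeta_le_upperSub hc x _ hw
    have hu' := zeta_le_upperSub hc x _ hw'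
    obtain ⟨e, he, _, ⟨v, hv, rfl⟩, rfl⟩ := Submodule.mem_sup.1 hw
    rw [map_add, formW_lower_upper i hu' he, zero_add]
    obtain ⟨e', he', _, ⟨v', hv', rfl⟩, rfl⟩ := Submodule.mem_sup.1 hw'
    rw [map_add, LinearMap.add_apply, formW_swap e', formW_lower_upper i.rev _ he', neg_zero,
      zero_add, hbc]
    · exact h hv v' hv'
    · rw [Fin.rev_rev]
      exact winMap_mem_upperSub i v

theorem torusActW_zeta (hc : ∀ q, c q ≠ 0) (t : Fin (2 * n) → ℂˣ) (x : AmbV n) :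
    zeta hc (torusActV t x) = torusActW t (zeta hc x) := by
  symm
  funext i
  apply Gr.eq_of_le
  rintro _ ⟨w, hw, rfl⟩
  obtain ⟨e, he, _, ⟨v, hv, rfl⟩, rfl⟩ := Submodule.mem_sup.1 hw
  change diagAut t (e + winMap c i v) ∈ _
  rw [map_add]
  refine Submodule.add_mem_sup ?_ ⟨diagAut (weightV t i) v, ⟨v, hv, rfl⟩, ?_⟩
  · intro q hq
    change (t q : ℂ) * e q = 0
    rw [he q hq, mul_zero]
  · funext q
    change _ = (t q : ℂ) * winMap c i v q
    by_cases h : (i : ℕ) ≤ q ∧ (q : ℕ) < n + 1 + i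
    · rw [← win_winInv i h.1 h.2, winMap_win, winMap_win]
      have h1 : diagAut (weightV t i) v (winInv q) = (t (win i (winInv q)) : ℂ) * v (winInv q) := by
        change (weightV t i (winInv q) : ℂ) * _ = _
        congr 2
        unfold weightV win
        split_ifs <;> rfl
      rw [h1]
      ring
    · rw [winMap_eq_zero c i _ h, winMap_eq_zero c i _ h, mul_zero]

/-! ### Regularity -/

/-- The indices of the basis vectors of `⟨e_1, …, e_{i-1}⟩ ⊕ π_i(V_i)`. -/
def frameEquiv (j : ℕ) : Fin j ⊕ Fin (j + 1) ≃ Fin (2 * j + 1) :=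
  finSumFinEquiv.trans (finCongr (by omega))

/-- The basis of `⟨e_1, …, e_{i-1}⟩ ⊕ π_i(V_i)` obtained from a basis of `V_i`. -/
def extFrame (c : Fin (2 * n) → ℂ) (i : Fin n) (v : Fin ((i : ℕ) + 1) → Fin (n + 1) → ℂ) :
    Fin (2 * (i : ℕ) + 1) → Fin (2 * n) → ℂ := fun r =>
  Sum.elim (fun a : Fin (i : ℕ) => (Pi.single ⟨a, by omega⟩ 1 : Fin (2 * n) → ℂ))
    (fun a => winMap c i (v a)) ((frameEquiv i).symm r)

theorem span_extFrame (hc : ∀ q, c q ≠ 0) (x : AmbV n) (i : Fin n) :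
    Submodule.span ℂ (Set.range (extFrame c i (x i).frame)) = (zeta hc x i).space := by
  have h1 : Set.range (extFrame c i (x i).frame) =
      Set.range (fun a : Fin (i : ℕ) => (Pi.single ⟨a, by omega⟩ 1 : Fin (2 * n) → ℂ)) ∪
        Set.range (fun a => winMap c i ((x i).frame a)) := by
    rw [← Set.Sum.elim_range, ← (frameEquiv i).symm.surjective.range_comp]
    rfl
  rw [h1, Submodule.span_union, zeta_space]
  congr 1
  · rw [lowerSub, coordSub_eq_span]
    congr 1
    ext v
    constructor
    · rintro ⟨a, rfl⟩
      exact ⟨⟨⟨a, by omega⟩, a.2⟩, rfl⟩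
    · rintro ⟨⟨q, hq⟩, rfl⟩
      exact ⟨⟨q, hq⟩, rfl⟩
  · rw [← (x i).span_frame, Submodule.map_span, ← Set.range_comp]
    rfl

theorem extFrame_update (i : Fin n) (v : Fin ((i : ℕ) + 1) → Fin (n + 1) → ℂ)
    (a : Fin ((i : ℕ) + 1)) (w : Fin (n + 1) → ℂ) :
    extFrame c i (Function.update v a w) =
      Function.update (extFrame c i v) (frameEquiv i (Sum.inr a)) (winMap c i w) := by
  funext r
  obtain ⟨p, rfl⟩ := (frameEquiv i).surjective r
  rcases p with p | p
  · rw [Function.update_of_ne (by simp)]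
    simp [extFrame]
  · by_cases h : p = a
    · subst h
      simp [extFrame]
    · rw [Function.update_of_ne (by simpa using h)]
      simp [extFrame, h]

/-- The minors of `extFrame c i v` as alternating functions of `v`. -/
def extMinor (c : Fin (2 * n) → ℂ) (i : Fin n) (g : Fin (2 * (i : ℕ) + 1) → Fin (2 * n)) :
    (Fin (n + 1) → ℂ) [⋀^Fin ((i : ℕ) + 1)]→ₗ[ℂ] ℂ where
  toFun v := minor g (extFrame c i v)
  map_update_add' := by
    intro inst v a w w'
    -- The field quantifies over an arbitrary decidable equality, whereas `extFrame_update` is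
    -- stated with the standard one.
    rw [Subsingleton.elim inst (instDecidableEqFin _)]
    simp only [extFrame_update, map_add, AlternatingMap.map_update_add]
  map_update_smul' := by
    intro inst v a s w
    rw [Subsingleton.elim inst (instDecidableEqFin _)]
    simp only [extFrame_update, map_smul, AlternatingMap.map_update_smul]
  map_eq_zero_of_eq' := by
    intro v a a' h hne
    refine AlternatingMap.map_eq_zero_of_eq _ _ (i := frameEquiv i (Sum.inr a))
      (j := frameEquiv i (Sum.inr a')) ?_ (by simpa using hne)
    simp [extFrame, h]

/-- The rows of the minor of `extFrame c i v` which equals, up to a constant, the minor of `v` on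
the rows `J`. -/
def extRows (i : Fin n) (J : Fin ((i : ℕ) + 1) → Fin (n + 1)) :
    Fin (2 * (i : ℕ) + 1) → Fin (2 * n) := fun r =>
  Sum.elim (fun a : Fin (i : ℕ) => (⟨a, by omega⟩ : Fin (2 * n))) (fun a => win i (J a))
    ((frameEquiv i).symm r)

/-- On these rows the extended frame is block diagonal: an identity block from `lowerSub i` and the
rescaled rows `J` of `v`. It expresses Plücker coordinates of `V_i` by those of `W_i`, hence makes
the inverse map regular. -/
theorem minor_extRows (i : Fin n) (J : Fin ((i : ℕ) + 1) → Fin (n + 1))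
    (v : Fin ((i : ℕ) + 1) → Fin (n + 1) → ℂ) :
    minor (extRows i J) (extFrame c i v) = (∏ a, c (win i (J a))) * minor J v := by
  rw [minor_apply, minor_apply, ← Matrix.det_diagonal, ← Matrix.det_mul,
    ← Matrix.det_submatrix_equiv_self (frameEquiv i)]
  have : (Matrix.of fun a r => extFrame c i v r (extRows i J a)).submatrix (frameEquiv i)
      (frameEquiv i) = Matrix.fromBlocks 1 0 0
        (Matrix.diagonal (fun a => c (win i (J a))) * Matrix.of fun a r => v r (J a)) := by
    ext p r
    rcases p with p | p <;> rcases r with r | r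
    · simp [extFrame, extRows, Matrix.one_apply, Pi.single_apply, Fin.ext_iff]
    · simp only [Matrix.submatrix_apply, Matrix.of_apply, extFrame, extRows,
        Equiv.symm_apply_apply, Sum.elim_inl, Sum.elim_inr, Matrix.fromBlocks_apply₁₂,
        Matrix.zero_apply]
      exact winMap_eq_zero c i _ fun h => not_le_of_gt p.2 h.1
    · simp only [Matrix.submatrix_apply, Matrix.of_apply, extFrame, extRows,
        Equiv.symm_apply_apply, Sum.elim_inl, Sum.elim_inr, Matrix.fromBlocks_apply₂₁,
        Matrix.zero_apply]
      refine Pi.single_eq_of_ne (fun h => ?_) 1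
      have h1 := le_win i (J p)
      rw [h] at h1
      exact not_le_of_gt r.2 h1
    · simp [extFrame, extRows, winMap_win]
  rw [this, Matrix.det_fromBlocks_zero₂₁, Matrix.det_one, one_mul]

theorem isVarietyIso_of_eq_zeta (hc : ∀ q, c q ≠ 0) {X : Set (AmbV n)} {Y : Set (AmbW n)}
    (φ : X ≃ Y) (hφ : ∀ x, (φ x).1 = zeta hc x.1) : IsVarietyIso φ := by
  constructor
  · refine isRegularMap_of_alternating φ id (fun j I => extMinor c j I) fun x j => ?_
    obtain ⟨a, ha, hf⟩ := exists_scalar_of_span_eq _ _ (span_extFrame hc x.1 j)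
    refine ⟨a, ha, fun I => ?_⟩
    rw [hφ, Gr.plucker_eq, ← hf]
    rfl
  · refine isRegularMap_of_alternating φ.symm id
      (fun j J => (∏ a, c (win j (J a)))⁻¹ • minor (extRows j J)) fun y j => ?_
    obtain ⟨x, rfl⟩ := φ.surjective y
    obtain ⟨a, ha, hf⟩ := exists_scalar_of_span_eq _ _ (span_extFrame hc x.1 j)
    refine ⟨a⁻¹, inv_ne_zero ha, fun J => ?_⟩
    have h1 := hf (minor (extRows j J))
    rw [minor_extRows, ← hφ] at h1
    have h2 : (∏ a, c (win j (J a))) ≠ 0 := Finset.prod_ne_zero_iff.2 fun a _ => hc _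
    rw [Equiv.symm_apply_apply, Gr.plucker_eq, AlternatingMap.smul_apply, smul_eq_mul,
      inv_mul_eq_iff_eq_mul₀ h2, mul_left_comm, h1, inv_mul_cancel_left₀ ha]
    rfl

end

/-! ### The comparison of the symplectic forms -/

/-- The value of `b` on `f_k` and its dual vector. -/
def dualValue {n : ℕ} (b : LinearMap.BilinForm ℂ (Fin (n + 1) → ℂ)) (k : Fin (n + 1)) : ℂ :=
  ∑ l, b (Pi.single k 1) (Pi.single l 1)

/-- The scalars by which the basis of `W` is rescaled to match the forms. -/
def scaling {n : ℕ} (b : LinearMap.BilinForm ℂ (Fin (n + 1) → ℂ)) (q : Fin (2 * n)) : ℂ :=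
  if h : (q : ℕ) < n then dualValue b ⟨q, by omega⟩ else 1

section

variable {n : ℕ} {b : LinearMap.BilinForm ℂ (Fin (n + 1) → ℂ)}

theorem IsAdaptedForm.dualValue_eq (hb : IsAdaptedForm b) {k l : Fin (n + 1)}
    (h : IsDualIndex k l) : dualValue b k = b (Pi.single k 1) (Pi.single l 1) := by
  rw [dualValue, Finset.sum_eq_single l]
  · intro l' _ hl'
    apply hb.eq_zero
    intro h'
    apply hl'
    apply Fin.ext
    unfold IsDualIndex at h h'
    omega
  · simp

/-- If the value on the only dual vector were zero, the basis vector would lie in the radical of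
`b`. -/
theorem IsAdaptedForm.scaling_ne_zero (hb : IsAdaptedForm b) (q : Fin (2 * n)) :
    scaling b q ≠ 0 := by
  unfold scaling
  split_ifs with hq
  · set k : Fin (n + 1) := ⟨q, by omega⟩ with hk
    obtain ⟨l, hl⟩ : ∃ l : Fin (n + 1), IsDualIndex k l := by
      by_cases h : (q : ℕ) + 1 = n
      · exact ⟨⟨n, by omega⟩, Or.inr (Or.inl ⟨h, rfl⟩)⟩
      · exact ⟨⟨n - 2 - q, by omega⟩, Or.inl (by change (q : ℕ) + (n - 2 - q) + 2 = n; omega)⟩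
    rw [hb.dualValue_eq hl]
    intro h0
    have h1 : (Pi.single k 1 : Fin (n + 1) → ℂ) = 0 := by
      apply hb.nondegenerate.1
      intro w
      rw [← Finset.univ_sum_single w, map_sum]
      refine Finset.sum_eq_zero fun r _ => ?_
      have h2 : (Pi.single r (w r) : Fin (n + 1) → ℂ) = w r • Pi.single r 1 := by
        ext
        simp [Pi.single_apply]
      rw [h2, map_smul]
      by_cases hr : IsDualIndex k r
      · have : r = l := by
          apply Fin.ext
          unfold IsDualIndex at hr hl
          omega
        rw [this, h0, smul_zero]
      · rw [hb.eq_zero k r hr, smul_zero]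
    simpa using congrFun h1 k
  · exact one_ne_zero

/-- Indices in dual windows sum to `2n-1` (zero-based) exactly when they come from dual vectors of
`V`, whatever `i` is. Of two such indices exactly one is below `n`; it carries the value of `b` as
its scaling factor and the other carries `1`. When the second index is the small one, the sign of
`formW` compensates for the order of arguments in the alternating form `b`. -/
theorem IsAdaptedForm.formW_winMap (hb : IsAdaptedForm b) (i : Fin n) (v w : Fin (n + 1) → ℂ) :
    formW n (winMap (scaling b) (Fin.rev i) v) (winMap (scaling b) i w) = b v w := by
  have key : (formW n).compl₁₂ (winMap (scaling b) (Fin.rev i)) (winMap (scaling b) i) = b := by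
    refine LinearMap.BilinForm.ext_basis (Pi.basisFun ℂ (Fin (n + 1))) fun k l => ?_
    rw [Pi.basisFun_apply, Pi.basisFun_apply, LinearMap.compl₁₂_apply, winMap_single,
      winMap_single, map_smul, map_smul, LinearMap.smul_apply, formW_single_left, smul_eq_mul,
      smul_eq_mul]
    have hwk := val_win (Fin.rev i) k
    have hwl := val_win i l
    rw [Fin.val_rev] at hwk
    by_cases h : IsDualIndex k l
    · have h' : IsDualIndex l k := by
        unfold IsDualIndex at h ⊢
        omega
      have h1 : (win (Fin.rev i) k).rev = win i l := by
        apply Fin.ext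
        rw [Fin.val_rev, hwk, hwl]
        unfold IsDualIndex at h
        split_ifs <;> omega
      have hbl : b (Pi.single k 1) (Pi.single l 1) = -dualValue b l := by
        rw [hb.dualValue_eq h', hb.isAlt.neg_eq]
      have hsum := congrArg Fin.val h1
      rw [Fin.val_rev] at hsum
      rw [h1, Pi.single_eq_same, mul_one]
      unfold scaling sgn
      by_cases hk : (win (Fin.rev i) k : ℕ) < n
      · have hk' : (⟨(win (Fin.rev i) k : ℕ), by omega⟩ : Fin (n + 1)) = k := by
          apply Fin.ext
          change (win (Fin.rev i) k : ℕ) = k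
          split_ifs at hwk <;> omega
        rw [dif_pos hk, dif_neg (by omega), if_pos hk, hk', hb.dualValue_eq h]
        ring
      · have hl' : (⟨(win i l : ℕ), by omega⟩ : Fin (n + 1)) = l := by
          apply Fin.ext
          change (win i l : ℕ) = l
          split_ifs at hwl <;> omega
        rw [dif_neg hk, dif_pos (by omega), if_neg hk, hl', hbl]
        ring
    · rw [hb.eq_zero k l h, Pi.single_eq_of_ne]
      · ring
      · intro h1
        apply h
        have h2 := congrArg Fin.val h1
        rw [Fin.val_rev, hwk, hwl] at h2
        unfold IsDualIndex
        split_ifs at h2 <;> omega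
  exact congrArg (fun B : LinearMap.BilinForm ℂ (Fin (n + 1) → ℂ) => B v w) key

theorem IsAdaptedForm.zeta_mem_iff (hb : IsAdaptedForm b) (x : AmbV n) :
    zeta hb.scaling_ne_zero x ∈ boundedFlags n ∩ iotaFixed (formW n) ↔ x ∈ spDegFlag b := by
  rw [spDegFlag, Set.mem_inter_iff, Set.mem_inter_iff,
    zeta_mem_iotaFixed_iff hb.scaling_ne_zero hb.nondegenerate hb.formW_winMap,
    ← zeta_mem_flagVariety_iff hb.scaling_ne_zero]
  refine and_congr_left fun _ => ⟨fun h => h.1, fun h => ⟨h, fun i => ⟨?_, ?_⟩⟩⟩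
  · exact lowerSub_le_zeta _ x i
  · exact zeta_le_upperSub _ x i

theorem IsAdaptedForm.torusActV_mem (hb : IsAdaptedForm b) {t : Fin (2 * n) → ℂˣ}
    (ht : t ∈ torusIota n) {x : AmbV n} (hx : x ∈ spDegFlag b) :
    torusActV t x ∈ spDegFlag b := by
  rw [← hb.zeta_mem_iff] at hx ⊢
  obtain ⟨g, hg, hgx⟩ := exists_torusActW_eq_smul ht
  rw [torusActW_zeta, hgx]
  exact ⟨smul_mem_boundedFlags hg.1 hx.1, smul_mem_iotaFixed hg.2 hx.2⟩

theorem IsAdaptedForm.isZariskiClosed_spDegFlag (hb : IsAdaptedForm b) :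
    IsZariskiClosed (spDegFlag b) :=
  (isZariskiClosed_degFlag n).inter (isZariskiClosed_iotaFixed b hb.nondegenerate
    fun i => by rw [Fin.val_rev]; omega)

end

/-- The isomorphism of the symplectic degenerate flag variety with the symplectic Schubert
variety. -/
def zetaEquiv {m n : ℕ} (hm : 1 ≤ m) (hn : n = 2 * m - 1)
    {b : LinearMap.BilinForm ℂ (Fin (n + 1) → ℂ)} (hb : IsAdaptedForm b) :
    ↥(spDegFlag b) ≃ ↥(schubertVariety (sigma n) ∩ iotaFixed (formW n)) :=
  Equiv.ofBijective (fun x => ⟨zeta hb.scaling_ne_zero x.1, by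
    rw [schubertVariety_inter_eq_boundedFlags_inter hm hn]
    exact (hb.zeta_mem_iff x.1).2 x.2⟩) (by
    constructor
    · intro x y h
      exact Subtype.ext (zeta_injective hb.scaling_ne_zero (congrArg Subtype.val h))
    · rintro ⟨y, hy⟩
      rw [schubertVariety_inter_eq_boundedFlags_inter hm hn] at hy
      obtain ⟨x, rfl⟩ := exists_zeta_eq hb.scaling_ne_zero hy.1.2
      exact ⟨⟨x, (hb.zeta_mem_iff x).1 hy⟩, rfl⟩)

end DegFlag

end

theorem theorem4p1 (m n : ℕ) (hm : 1 ≤ m) (hn : n = 2 * m - 1)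
    (b : LinearMap.BilinForm ℂ (Fin (n + 1) → ℂ)) (hb : DegFlag.IsAdaptedForm b) :
    DegFlag.IsZariskiClosed (DegFlag.spDegFlag b) ∧
    -- The fixed locus lies in `Sp_{2n}/Q` and is a Schubert variety there.
    DegFlag.schubertVariety (DegFlag.sigma n) ⊆ DegFlag.flagVariety n ∧
    DegFlag.schubertVariety (DegFlag.sigma n) ∩ DegFlag.iotaFixed (DegFlag.formW n) ⊆
      Set.range (DegFlag.embQ n) ∧
    DegFlag.schubertVariety (DegFlag.sigma n) ∩ DegFlag.iotaFixed (DegFlag.formW n) =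
      DegFlag.spSchubertVariety (DegFlag.sigma n) ∧
    -- The equivariant isomorphism.
    ∃ ζ : ↥(DegFlag.spDegFlag b) ≃
        ↥(DegFlag.schubertVariety (DegFlag.sigma n) ∩ DegFlag.iotaFixed (DegFlag.formW n)),
      DegFlag.IsVarietyIso ζ ∧
      ∀ t ∈ DegFlag.torusIota n, ∀ x : ↥(DegFlag.spDegFlag b),
        ∃ hx : DegFlag.torusActV t x.1 ∈ DegFlag.spDegFlag b,
          (ζ ⟨DegFlag.torusActV t x.1, hx⟩).1 = DegFlag.torusActW t (ζ x).1 := by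
  refine ⟨hb.isZariskiClosed_spDegFlag,
    (DegFlag.schubertVariety_subset_boundedFlags n).trans fun x hx => hx.1, ?_,
    DegFlag.schubertVariety_inter_eq hm hn, DegFlag.zetaEquiv hm hn hb,
    DegFlag.isVarietyIso_of_eq_zeta hb.scaling_ne_zero _ fun x => rfl,
    fun t ht x => ⟨hb.torusActV_mem ht x.2, DegFlag.torusActW_zeta hb.scaling_ne_zero t x.1⟩⟩
  rw [DegFlag.schubertVariety_inter_eq_boundedFlags_inter hm hn]
  exact DegFlag.boundedFlags_inter_subset_range hm hn
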